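/- **Setting.** A buyer wants one unit from one of $n\ge 2$ sellers. Qualities $q_1,\dots,q_n\in[0,1]$ are private information, i.i.d. with a continuous density $f$ on $[0,1]$ and distribution function $F$; $f>0$ on $(0,1]$, and if $f(0)=0$ then $F(q)/f(q)\to 0$ as $q\downarrow 0$ (in that case $F(0)/f(0)$ is read as $0$). A seller of quality $q$ who sells and receives a transfer $t$ has payoff $t-q$, and the buyer has payoff $v(q)-t$, where $v$ is continuous on $[0,1]$ with $v(0)\ge 0$. A direct mechanism consists of functions $p_s:[0,1]^n\to[0,1]$ with $\sum_s p_s\le 1$ and transfers $t_s:[0,1]^n\to\mathbb R$ (measurable, with well-defined expectations). With interim values $P_s(r)=\mathbb E[p_s(r,q_{-s})]$ and $T_s(r)=\mathbb E[t_s(r,q_{-s})]$, it is incentive-compatible if, for every seller $s$ and almost every $q$, $T_s(q)-qP_s(q)\ge T_s(r)-qP_s(r)$ for all $r\in[0,1]$. It is individually rational if $T_s(q)-qP_s(q)\ge 0$ for all $s$ and $q$ and the buyer's expected payoff $\pi_b=\sum_s\mathbb E[v(q_s)p_s(q)-t_s(q)]$ is non-negative. A mechanism is *buyer-optimal* if it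 maximizes $\pi_b$ among all incentive-compatible and individually rational direct mechanisms. **Bid-restricted auction (BRA).** It has $M\ge1$ bid intervals $[\underline b_i,\overline b_i]$, with $0\le\underline b_1$, $\overline b_M\le1$, $\underline b_i\le\overline b_i$ and $\overline b_i<\underline b_{i+1}$. A seller stays out or bids in one of the intervals; the lowest bid wins, with ties broken uniformly. The winner is paid the second-lowest bid (taken to be $\overline b_M$ if there is only one bid), except that, if the winning bid is the only bid in its interval $i$ and the second-lowest bid equals $\underline b_j$ with $j>i$, bid by $k$ sellers, she is paid $(\underline b_j+k\overline b_{j-1})/(k+1)$. With $\overline b_0:=0$, consider the strategy: stay out if $q\ge\overline b_M$; bid $q$ if $q\in[\underline b_i,\overline b_i)$; bid $\underline b_i$ if $q\in[\overline b_{i-1},\underline b_i)$. A BRA is called buyer-optimal if this strategy is weakly dominant (at least as good as any other bid, whatever the others bid) and the direct mechanism it induces is buyer-optimal. **Ironing.** Let $g(q)=v(q)-q-F(q)/f(q)$, let $G(s)=\int_0^s g(F^{-1}(x))\,dx$ on $[0,1]$, let $\overline G$ be the concave hull of $G$ and $\overline g$ the right derivative of $\overline G$ on $[0,1)$, and let $\overline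 S=\sup\{s\in[0,1):\overline g(s)\ge0\}$, with $\sup\varnothing=0$. A finite family of *pooling intervals* consists of disjoint nonempty intervals $[\underline s_i,\overline s_i)$, $i=1,\dots,L$ ($L\ge0$), contained in $[0,\overline S]$ and listed from left to right, such that $\overline G$ is affine on each of them and $\overline G=G$ on $[0,\overline S]\setminus\bigcup_i(\underline s_i,\overline s_i)$. **Theorem.** Suppose that $g$ is structured: $[0,1]$ has a finite partition into intervals on each of which $g$ is weakly increasing or weakly decreasing. Then a finite family of pooling intervals exists. Moreover, for every such family the BRA with the following bid intervals is well defined and buyer-optimal. * If $L\ge1$ and $\underline s_1=0$, then $M=L$, $[\underline b_i,\overline b_i]=[F^{-1}(\overline s_i),F^{-1}(\underline s_{i+1})]$ for $1\le i<L$, and $[\underline b_L,\overline b_L]=[F^{-1}(\overline s_L),F^{-1}(\overline S)]$. * If $L=0$ or $\underline s_1>0$, then $M=L+1$, and the interval $[\underline b_i,\overline b_i]$ has lower endpoint $0$ for $i=1$ and $F^{-1}(\overline s_{i-1})$ for $i\ge2$, and upper endpoint $F^{-1}(\underline s_i)$ for $i\le L$ and $F^{-1}(\overline S)$ for $i=L+1$.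 -/

import Mathlib

open MeasureTheory Set Filter Topology

noncomputable section

open scoped Classical

namespace Procurement

/-! ### Primitives: quality distribution, virtual surplus -/

/-- Cumulative distribution function of the density `f` on `[0,1]`. -/
def cdf (f : ℝ → ℝ) (q : ℝ) : ℝ := ∫ x in (0 : ℝ)..q, f x

/-- The inverse `F⁻¹ : [0,1] → [0,1]` of the distribution function. -/
def quantile (f : ℝ → ℝ) : ℝ → ℝ := Function.invFunOn (cdf f) (Icc 0 1)

/-- The law of one seller's quality: density `f` on `[0,1]`. -/
def qualityLaw (f : ℝ → ℝ) : Measure ℝ :=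
  (volume.restrict (Icc (0 : ℝ) 1)).withDensity fun x => ENNReal.ofReal (f x)

/-- The law of the profile of `n` i.i.d. qualities. -/
def profileLaw (f : ℝ → ℝ) (n : ℕ) : Measure (Fin n → ℝ) :=
  Measure.pi fun _ => qualityLaw f

/-- The buyer's virtual surplus `g = v - q - F / f`. If `f 0 = 0`, the value of `F / f` at `0` is
`0 / 0 = 0`, which is then also its limit at `0` by assumption. -/
def virtualSurplus (f v : ℝ → ℝ) (q : ℝ) : ℝ := v q - q - cdf f q / f q

/-- `h` is structured: there is a finite partition of `[0,1]` into intervals on each of which `h`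
is (weakly) increasing or (weakly) decreasing. -/
def Structured (h : ℝ → ℝ) : Prop :=
  ∃ parts : Set (Set ℝ), parts.Finite ∧ parts.PairwiseDisjoint id ∧ ⋃₀ parts = Icc (0 : ℝ) 1 ∧
    ∀ I ∈ parts, I.OrdConnected ∧ (MonotoneOn h I ∨ AntitoneOn h I)

/-! ### Ironing -/

/-- `G(s) = ∫₀ˢ g(F⁻¹(x)) dx`. -/
def cumSurplus (f v : ℝ → ℝ) (s : ℝ) : ℝ :=
  ∫ x in (0 : ℝ)..s, virtualSurplus f v (quantile f x)

/-- Concave hull of a function on `[0,1]`: the upper boundary of the convex hull of its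
hypograph. -/
def concaveHull (G : ℝ → ℝ) (x : ℝ) : ℝ :=
  sSup {y : ℝ | (x, y) ∈ convexHull ℝ {z : ℝ × ℝ | z.1 ∈ Icc (0 : ℝ) 1 ∧ z.2 ≤ G z.1}}

/-- `Ḡ`, the concave hull of `G`. -/
def ironedCumSurplus (f v : ℝ → ℝ) : ℝ → ℝ := concaveHull (cumSurplus f v)

/-- `ḡ`, the right derivative of `Ḡ` (meaningful on `[0,1)`). -/
def ironedSurplus (f v : ℝ → ℝ) (s : ℝ) : ℝ :=
  derivWithin (ironedCumSurplus f v) (Ioi s) s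

/-- The exclusion cutoff `S̄ = sup {s : ḡ(s) ≥ 0}`, with `sup ∅ = 0`. The point `s = 1`, at which
there is no right derivative, is left out; this does not affect the supremum because `ḡ` is
decreasing. -/
def exclusionCutoff (f v : ℝ → ℝ) : ℝ :=
  sSup {s : ℝ | s ∈ Ico (0 : ℝ) 1 ∧ 0 ≤ ironedSurplus f v s}

/-- `[lo i, hi i)`, `i = 1, …, L`, are pooling intervals, listed from left to right: disjoint
nonempty subintervals of `[0, S̄]` on each of which `Ḡ` is affine, and such that `Ḡ = G` at
every point of `[0, S̄]` that is not interior to one of them.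
(At the left endpoint of an interval, `Ḡ = G` holds automatically by continuity, unless that
endpoint is also the right endpoint of the preceding interval. The condition there says that one
interval on which `G < Ḡ` may not be cut into two pooling intervals.) -/
structure IsPooling (f v : ℝ → ℝ) (L : ℕ) (lo hi : ℕ → ℝ) : Prop where
  nonneg : ∀ i, 1 ≤ i → i ≤ L → 0 ≤ lo i
  lo_lt_hi : ∀ i, 1 ≤ i → i ≤ L → lo i < hi i
  hi_le : ∀ i, 1 ≤ i → i ≤ L → hi i ≤ exclusionCutoff f v
  ordered : ∀ i, 1 ≤ i → i < L → hi i ≤ lo (i + 1)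
  affine : ∀ i, 1 ≤ i → i ≤ L →
    ∃ a c : ℝ, ∀ s ∈ Ico (lo i) (hi i), ironedCumSurplus f v s = a + c * s
  coincide : ∀ s ∈ Icc (0 : ℝ) (exclusionCutoff f v),
    (∀ i, 1 ≤ i → i ≤ L → s ∉ Ioo (lo i) (hi i)) → ironedCumSurplus f v s = cumSurplus f v s

/-! ### Direct mechanisms -/

/-- A direct mechanism: `p s q` is the probability that the buyer procures from seller `s`, and
`t s q` the transfer to seller `s`, when the reported qualities are `q` (in the unit cube). -/
structure DirectMechanism (n : ℕ) where
  p : Fin n → (Fin n → ℝ) → ℝ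
  t : Fin n → (Fin n → ℝ) → ℝ

namespace DirectMechanism

variable {n : ℕ}

/-- `p` and `t` are Borel functions, the (interim and ex ante) expected transfers exist, and at
every report profile the `p s` are probabilities that sum to at most one. -/
structure Feasible (m : DirectMechanism n) (f : ℝ → ℝ) : Prop where
  measurable_p : ∀ s, Measurable (m.p s)
  measurable_t : ∀ s, Measurable (m.t s)
  integrable_t : ∀ s, Integrable (m.t s) (profileLaw f n)
  integrable_interim : ∀ s, ∀ r ∈ Icc (0 : ℝ) 1,
    Integrable (fun q => m.t s (Function.update q s r)) (profileLaw f n)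
  p_mem : ∀ s, ∀ q, (∀ k, q k ∈ Icc (0 : ℝ) 1) → m.p s q ∈ Icc (0 : ℝ) 1
  sum_p_le : ∀ q, (∀ k, q k ∈ Icc (0 : ℝ) 1) → ∑ s, m.p s q ≤ 1

/-- Interim allocation probability of seller `s` from reporting `r`. The own coordinate of the
random profile is overwritten by the report, so this is an expectation over the other sellers'
qualities. -/
def interimP (m : DirectMechanism n) (f : ℝ → ℝ) (s : Fin n) (r : ℝ) : ℝ :=
  ∫ q, m.p s (Function.update q s r) ∂(profileLaw f n)

/-- Interim expected transfer to seller `s` from reporting `r`. -/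
def interimT (m : DirectMechanism n) (f : ℝ → ℝ) (s : Fin n) (r : ℝ) : ℝ :=
  ∫ q, m.t s (Function.update q s r) ∂(profileLaw f n)

/-- Expected payoff of seller `s` of quality `x` from reporting `r`. -/
def sellerPayoff (m : DirectMechanism n) (f : ℝ → ℝ) (s : Fin n) (r x : ℝ) : ℝ :=
  m.interimT f s r - x * m.interimP f s r

/-- The buyer's expected payoff. -/
def buyerPayoff (m : DirectMechanism n) (f v : ℝ → ℝ) : ℝ :=
  ∑ s, ∫ q, (v (q s) * m.p s q - m.t s q) ∂(profileLaw f n)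

/-- Incentive compatibility: for almost every quality, truth-telling is an optimal report. -/
def IncentiveCompatible (m : DirectMechanism n) (f : ℝ → ℝ) : Prop :=
  ∀ s, ∀ᵐ x ∂(volume.restrict (Icc (0 : ℝ) 1)), ∀ r ∈ Icc (0 : ℝ) 1,
    m.sellerPayoff f s r x ≤ m.sellerPayoff f s x x

/-- Individual rationality, for the buyer and for every seller. -/
def IndividuallyRational (m : DirectMechanism n) (f v : ℝ → ℝ) : Prop :=
  0 ≤ m.buyerPayoff f v ∧ ∀ s, ∀ x ∈ Icc (0 : ℝ) 1, 0 ≤ m.sellerPayoff f s x x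

/-- The constraint set of the procurement problem. -/
def Admissible (m : DirectMechanism n) (f v : ℝ → ℝ) : Prop :=
  m.Feasible f ∧ m.IncentiveCompatible f ∧ m.IndividuallyRational f v

/-- `m` maximizes the buyer's expected payoff among all feasible, incentive-compatible and
individually rational direct mechanisms, and is one of them. -/
def BuyerOptimal (m : DirectMechanism n) (f v : ℝ → ℝ) : Prop :=
  m.Admissible f v ∧
    ∀ m' : DirectMechanism n, m'.Admissible f v → m'.buyerPayoff f v ≤ m.buyerPayoff f v

end DirectMechanism

/-! ### Bid-restricted auctions -/

/-- The data of a bid-restricted auction: bid intervals `[lower i, upper i]`, `i = 1, …, M`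
(values at other indices are irrelevant). -/
structure BRA where
  M : ℕ
  lower : ℕ → ℝ
  upper : ℕ → ℝ

namespace BRA

variable {n : ℕ}

/-- The requirements on the bid intervals. -/
structure Valid (B : BRA) : Prop where
  one_le : 1 ≤ B.M
  nonneg : 0 ≤ B.lower 1
  le_one : B.upper B.M ≤ 1
  lower_le_upper : ∀ i, 1 ≤ i → i ≤ B.M → B.lower i ≤ B.upper i
  gap : ∀ i, 1 ≤ i → i < B.M → B.upper i < B.lower (i + 1)

/-- The bid `b` lies in the `i`-th bid interval. The bid `⊤` stands for not participating. -/
def InInterval (B : BRA) (i : ℕ) (b : WithTop ℝ) : Prop :=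
  1 ≤ i ∧ i ≤ B.M ∧ (B.lower i : WithTop ℝ) ≤ b ∧ b ≤ (B.upper i : WithTop ℝ)

/-- Permissible actions: staying out, or a bid in one of the bid intervals. -/
def Permissible (B : BRA) (b : WithTop ℝ) : Prop :=
  b = ⊤ ∨ ∃ i, B.InInterval i b

/-- Probability that seller `s` wins: the lowest bid wins, ties are broken uniformly. -/
def winProb (b : Fin n → WithTop ℝ) (s : Fin n) : ℝ :=
  if b s ≠ ⊤ ∧ ∀ k, b s ≤ b k then
    1 / ((Finset.univ.filter fun k => b k = b s).card : ℝ)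
  else 0

/-- The second-lowest bid when `s` is the winner, i.e. the lowest of the other sellers' bids
(which equals the winning bid in case of a tie); by convention it is the highest permissible bid
if nobody else bids. -/
def secondLowest (B : BRA) (b : Fin n → WithTop ℝ) (s : Fin n) : ℝ :=
  ((Finset.univ.erase s).inf b).untopD (B.upper B.M)

/-- The payment reduction rule applies to winner `s`, with index `j`: the bid of `s` is the only
bid in its bid interval `i`, and the second-lowest bid is the lower endpoint of the interval `j`,
where `j > i`. -/
def Reduces (B : BRA) (b : Fin n → WithTop ℝ) (s : Fin n) (j : ℕ) : Prop :=
  ∃ i, B.InInterval i (b s) ∧ (∀ k, k ≠ s → ¬ B.InInterval i (b k)) ∧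
    i < j ∧ j ≤ B.M ∧ B.secondLowest b s = B.lower j

/-- The payment to `s` if she wins. (The index `j` in the payment reduction rule is unique.) -/
def payment (B : BRA) (b : Fin n → WithTop ℝ) (s : Fin n) : ℝ :=
  if ∃ j, B.Reduces b s j then
    let j := sInf {j | B.Reduces b s j}
    let k : ℝ := ((Finset.univ.filter fun l => b l = (B.lower j : WithTop ℝ)).card : ℝ)
    (B.lower j + k * B.upper (j - 1)) / (k + 1)
  else B.secondLowest b s

/-- Expected payoff of seller `s` of quality `x` at the bid profile `b`. -/
def payoff (B : BRA) (b : Fin n → WithTop ℝ) (s : Fin n) (x : ℝ) : ℝ :=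
  winProb b s * (B.payment b s - x)

/-- The bidding strategy: stay out if the quality `x` is at least `upper M`; otherwise
`upper (i - 1) ≤ x < upper i` for exactly one `i` (with `upper 0` read as `0`), and the bid is
`x` if `lower i ≤ x`, and `lower i` if `x < lower i`. -/
def bid (B : BRA) (x : ℝ) : WithTop ℝ :=
  if x < B.upper B.M then
    let i := sInf {i : ℕ | 1 ≤ i ∧ i ≤ B.M ∧ x < B.upper i}
    ((if B.lower i ≤ x then x else B.lower i : ℝ) : WithTop ℝ)
  else ⊤

/-- Bidding according to `bid` is a weakly dominant strategy in the auction with `n` sellers: it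
is permissible and, whatever permissible bids `b k` the other sellers make, no other permissible
own bid `b s` does better. -/
def BidWeaklyDominant (B : BRA) (n : ℕ) : Prop :=
  ∀ s : Fin n, ∀ x ∈ Icc (0 : ℝ) 1, B.Permissible (B.bid x) ∧
    ∀ b : Fin n → WithTop ℝ, (∀ k, B.Permissible (b k)) →
      B.payoff b s x ≤ B.payoff (Function.update b s (B.bid x)) s x

/-- The direct mechanism induced by the auction when all sellers bid according to `bid`. -/
def toDirect (B : BRA) (n : ℕ) : DirectMechanism n where
  p s q := winProb (fun k => B.bid (q k)) s
  t s q := winProb (fun k => B.bid (q k)) s * B.payment (fun k => B.bid (q k)) s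

end BRA

/-- The bid-restricted auction whose bid intervals are the images under `F⁻¹` of the non-pooling
intervals between the pooling intervals `[lo i, hi i)`, `i = 1, …, L`, with top bid `F⁻¹(S̄)`. -/
def poolingBRA (f v : ℝ → ℝ) (L : ℕ) (lo hi : ℕ → ℝ) : BRA :=
  if 1 ≤ L ∧ lo 1 = 0 then
    { M := L
      lower := fun i => quantile f (hi i)
      upper := fun i =>
        if i < L then quantile f (lo (i + 1)) else quantile f (exclusionCutoff f v) }
  else
    { M := L + 1
      lower := fun i => if i = 1 then 0 else quantile f (hi (i - 1))
      upper := fun i => if i ≤ L then quantile f (lo i) else quantile f (exclusionCutoff f v) }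

end Procurement

end

/-!
A buyer-optimal mechanism is found by bounding the buyer's payoff for all mechanisms and showing that
the auction attains the bound.

*Upper bound.* The indirect utility `sup_r (T r - x * P r)` of a seller is Lipschitz with derivative
`-P` almost everywhere, so integration by parts turns the expected information rents into
`∫ F * P` (`Primitives.integral_surplus_eq`). Hence the buyer's payoff is the expected virtual
surplus `g` of the winner, less the rents of sellers of quality `1` (`Primitives.buyerPayoff_eq`).
Interim winning probabilities are decreasing almost everywhere. By the layer-cake formula, integrals
against them are averages of integrals over initial segments `[0, c]`, and over such a segment
replacing `g` by `ḡ ∘ F` adds `Ḡ (F c) - G (F c) ≥ 0`. Thus the expected ironed surplus of the winner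
is an upper bound (`Primitives.buyerPayoff_le`), with equality if the winning probabilities jump
only at points where `Ḡ = G` and sellers of quality `1` earn nothing
(`Primitives.buyerPayoff_eq_of_levels`).

*The auction.* The payment reduction rule makes the strategy weakly dominant
(`BRA.Valid.payoff_le`), so the induced direct mechanism is incentive-compatible and individually
rational. Bids are increasing in quality and constant exactly on the pooling intervals, up to null
sets. There `ḡ` is constant as well, so the winner almost surely has the highest non-negative ironed
surplus (`Adapted.ae_sum_ironedSurplus_le`), while the winning probabilities jump only where `Ḡ = G`
(`Adapted.coincide_of_isLUB`).

*Existence of pooling intervals.* The components of `{G < Ḡ}` are intervals on which `Ḡ` is affine.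
Where `g` is decreasing, `G` is concave and contains no complete component; where `g` is increasing,
`Ḡ - G` is concave and there is at most one (`finite_isGap`). The cutoff `S̄` is not interior to a
component because `ḡ` is constant there.
-/

noncomputable section

open scoped Classical

namespace Procurement

/-! ### The quality distribution -/

/-- The standing assumptions on the density `f` and on the buyer's valuation `v`. -/
structure Primitives (f v : ℝ → ℝ) : Prop where
  cont : ContinuousOn f (Icc 0 1)
  pos : ∀ q ∈ Ioc (0 : ℝ) 1, 0 < f q
  int : ∫ x in (0 : ℝ)..1, f x = 1
  zero : f 0 = 0 → Tendsto (fun q => cdf f q / f q) (𝓝[>] 0) (𝓝 0)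
  v_cont : ContinuousOn v (Icc 0 1)

namespace Primitives

variable {f v : ℝ → ℝ} (h : Primitives f v)
include h

lemma f_nonneg {x : ℝ} (hx : x ∈ Icc (0 : ℝ) 1) : 0 ≤ f x := by
  have hcl : closure (Ioc (0 : ℝ) 1) = Icc 0 1 := closure_Ioc (by norm_num)
  exact ContinuousWithinAt.closure_le (s := Ioc (0 : ℝ) 1) (by rwa [hcl])
    continuousWithinAt_const ((h.cont x hx).mono Ioc_subset_Icc_self) (fun y hy => (h.pos y hy).le)

lemma intervalIntegrable_f {a b : ℝ} (ha : a ∈ Icc (0 : ℝ) 1) (hb : b ∈ Icc (0 : ℝ) 1) :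
    IntervalIntegrable f volume a b :=
  (h.cont.mono (ordConnected_Icc.uIcc_subset ha hb)).intervalIntegrable

omit h in
lemma cdf_zero : cdf f 0 = 0 := by simp [cdf]

lemma cdf_one : cdf f 1 = 1 := h.int

lemma hasDerivAt_cdf {x : ℝ} (hx : x ∈ Ioo (0 : ℝ) 1) : HasDerivAt (cdf f) (f x) x := by
  refine intervalIntegral.integral_hasDerivAt_right
    (h.intervalIntegrable_f (by simp) (Ioo_subset_Icc_self hx)) ?_
    (h.cont.continuousAt (Icc_mem_nhds hx.1 hx.2))
  exact ContinuousOn.stronglyMeasurableAtFilter isOpen_Ioo (h.cont.mono Ioo_subset_Icc_self) x hx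

lemma continuousOn_cdf : ContinuousOn (cdf f) (Icc 0 1) := by
  have := intervalIntegral.continuousOn_primitive_interval (f := f) (a := 0) (b := 1) (μ := volume)
    (by rw [uIcc_of_le zero_le_one]; exact h.cont.integrableOn_Icc)
  rwa [uIcc_of_le zero_le_one] at this

lemma strictMonoOn_cdf : StrictMonoOn (cdf f) (Icc 0 1) := by
  refine strictMonoOn_of_deriv_pos (convex_Icc 0 1) h.continuousOn_cdf fun x hx => ?_
  rw [interior_Icc] at hx
  rw [(h.hasDerivAt_cdf hx).deriv]
  exact h.pos x ⟨hx.1, hx.2.le⟩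

lemma cdf_mem {x : ℝ} (hx : x ∈ Icc (0 : ℝ) 1) : cdf f x ∈ Icc (0 : ℝ) 1 := by
  have h0 := h.strictMonoOn_cdf.monotoneOn (by simp) hx hx.1
  have h1 := h.strictMonoOn_cdf.monotoneOn hx (by simp) hx.2
  rw [cdf_zero] at h0
  rw [h.cdf_one] at h1
  exact ⟨h0, h1⟩

lemma cdf_mem_Ioo {x : ℝ} (hx : x ∈ Ioo (0 : ℝ) 1) : cdf f x ∈ Ioo (0 : ℝ) 1 := by
  have h0 := h.strictMonoOn_cdf (by simp) (Ioo_subset_Icc_self hx) hx.1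
  have h1 := h.strictMonoOn_cdf (Ioo_subset_Icc_self hx) (by simp) hx.2
  rw [cdf_zero] at h0
  rw [h.cdf_one] at h1
  exact ⟨h0, h1⟩

lemma surjOn_cdf : SurjOn (cdf f) (Icc 0 1) (Icc 0 1) := by
  have := intermediate_value_Icc zero_le_one h.continuousOn_cdf
  rwa [cdf_zero, h.cdf_one] at this

lemma quantile_mem {s : ℝ} (hs : s ∈ Icc (0 : ℝ) 1) : quantile f s ∈ Icc (0 : ℝ) 1 :=
  Function.invFunOn_mem (h.surjOn_cdf hs)

lemma cdf_quantile {s : ℝ} (hs : s ∈ Icc (0 : ℝ) 1) : cdf f (quantile f s) = s :=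
  Function.invFunOn_eq (h.surjOn_cdf hs)

lemma quantile_cdf {x : ℝ} (hx : x ∈ Icc (0 : ℝ) 1) : quantile f (cdf f x) = x :=
  h.strictMonoOn_cdf.injOn (h.quantile_mem (h.cdf_mem hx)) hx (h.cdf_quantile (h.cdf_mem hx))

lemma le_quantile_iff {x s : ℝ} (hx : x ∈ Icc (0 : ℝ) 1) (hs : s ∈ Icc (0 : ℝ) 1) :
    x ≤ quantile f s ↔ cdf f x ≤ s := by
  rw [← h.strictMonoOn_cdf.le_iff_le hx (h.quantile_mem hs), h.cdf_quantile hs]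

lemma quantile_le_iff {x s : ℝ} (hx : x ∈ Icc (0 : ℝ) 1) (hs : s ∈ Icc (0 : ℝ) 1) :
    quantile f s ≤ x ↔ s ≤ cdf f x := by
  rw [← h.strictMonoOn_cdf.le_iff_le (h.quantile_mem hs) hx, h.cdf_quantile hs]

lemma lt_quantile_iff {x s : ℝ} (hx : x ∈ Icc (0 : ℝ) 1) (hs : s ∈ Icc (0 : ℝ) 1) :
    x < quantile f s ↔ cdf f x < s := by
  rw [← not_le, h.quantile_le_iff hx hs, not_le]

lemma strictMonoOn_quantile : StrictMonoOn (quantile f) (Icc 0 1) := by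
  intro a ha b hb hab
  rwa [h.lt_quantile_iff (h.quantile_mem ha) hb, h.cdf_quantile ha]

lemma continuousOn_quantile : ContinuousOn (quantile f) (Icc 0 1) := by
  rw [continuousOn_iff_isClosed]
  intro t ht
  refine ⟨cdf f '' (t ∩ Icc 0 1), ?_, ?_⟩
  · exact ((isCompact_Icc.inter_left ht).image_of_continuousOn
      (h.continuousOn_cdf.mono inter_subset_right)).isClosed
  · ext s
    constructor
    · rintro ⟨h1, h2⟩
      exact ⟨⟨quantile f s, ⟨h1, h.quantile_mem h2⟩, h.cdf_quantile h2⟩, h2⟩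
    · rintro ⟨⟨x, ⟨hx1, hx2⟩, rfl⟩, h2⟩
      exact ⟨by rwa [mem_preimage, h.quantile_cdf hx2], h2⟩

/-! ### The virtual surplus and its primitive -/

/-- The virtual surplus is continuous up to `0`, also when the density vanishes there: this is
where the limit of `F / f` is needed. -/
lemma continuousOn_virtualSurplus : ContinuousOn (virtualSurplus f v) (Icc 0 1) := by
  refine (h.v_cont.sub continuousOn_id).sub ?_
  intro x hx
  by_cases hfx : f x = 0
  · have hx0 : x = 0 := by
      by_contra hne
      exact (h.pos x ⟨lt_of_le_of_ne hx.1 (Ne.symm hne), hx.2⟩).ne' hfx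
    subst hx0
    have h1 := h.zero hfx
    have h2 : ContinuousWithinAt (fun q => cdf f q / f q) (Ioi 0) 0 := by
      unfold ContinuousWithinAt
      simpa [hfx] using h1
    have h3 := continuousWithinAt_insert_self.2 h2
    exact h3.mono fun y hy => by
      rcases hy.1.eq_or_lt with h0 | h0
      · exact Or.inl h0.symm
      · exact Or.inr h0
  · exact (h.continuousOn_cdf x hx).div (h.cont x hx) hfx

lemma continuousOn_surplus_quantile :
    ContinuousOn (fun s => virtualSurplus f v (quantile f s)) (Icc 0 1) :=
  h.continuousOn_virtualSurplus.comp h.continuousOn_quantile fun _ hs => h.quantile_mem hs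

lemma exists_surplus_bound : ∃ K, 0 ≤ K ∧ ∀ x ∈ Icc (0 : ℝ) 1, |virtualSurplus f v x| ≤ K := by
  obtain ⟨K, hK⟩ := isCompact_Icc.exists_bound_of_continuousOn h.continuousOn_virtualSurplus
  exact ⟨K, (norm_nonneg _).trans (hK 0 (by simp)), hK⟩

omit h in
lemma cumSurplus_zero : cumSurplus f v 0 = 0 := by simp [cumSurplus]

lemma continuousOn_cumSurplus : ContinuousOn (cumSurplus f v) (Icc 0 1) := by
  have := intervalIntegral.continuousOn_primitive_interval
    (f := fun s => virtualSurplus f v (quantile f s)) (a := 0) (b := 1) (μ := volume)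
    (by rw [uIcc_of_le zero_le_one]; exact h.continuousOn_surplus_quantile.integrableOn_Icc)
  rwa [uIcc_of_le zero_le_one] at this

lemma hasDerivAt_cumSurplus {s : ℝ} (hs : s ∈ Ioo (0 : ℝ) 1) :
    HasDerivAt (cumSurplus f v) (virtualSurplus f v (quantile f s)) s := by
  refine intervalIntegral.integral_hasDerivAt_right
    (ContinuousOn.intervalIntegrable (h.continuousOn_surplus_quantile.mono ?_)) ?_
    (h.continuousOn_surplus_quantile.continuousAt (Icc_mem_nhds hs.1 hs.2))
  · exact ordConnected_Icc.uIcc_subset (by simp) (Ioo_subset_Icc_self hs)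
  · exact ContinuousOn.stronglyMeasurableAtFilter isOpen_Ioo
      (h.continuousOn_surplus_quantile.mono Ioo_subset_Icc_self) s hs

lemma abs_cumSurplus_sub_le {K : ℝ} (hK : ∀ x ∈ Icc (0 : ℝ) 1, |virtualSurplus f v x| ≤ K)
    {s t : ℝ} (hs : s ∈ Icc (0 : ℝ) 1) (ht : t ∈ Icc (0 : ℝ) 1) :
    |cumSurplus f v t - cumSurplus f v s| ≤ K * |t - s| := by
  have hint : ∀ a ∈ Icc (0 : ℝ) 1, ∀ b ∈ Icc (0 : ℝ) 1,
      IntervalIntegrable (fun s => virtualSurplus f v (quantile f s)) volume a b :=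
    fun a ha b hb => ContinuousOn.intervalIntegrable
      (h.continuousOn_surplus_quantile.mono (ordConnected_Icc.uIcc_subset ha hb))
  rw [cumSurplus, cumSurplus, intervalIntegral.integral_interval_sub_left
    (hint 0 (by simp) t ht) (hint 0 (by simp) s hs)]
  refine intervalIntegral.norm_integral_le_of_norm_le_const (E := ℝ) fun x hx => ?_
  exact hK _ (h.quantile_mem (ordConnected_Icc.uIcc_subset hs ht (uIoc_subset_uIcc hx)))

/-! ### The quality law -/

lemma aemeasurable_f : AEMeasurable f (volume.restrict (Icc (0 : ℝ) 1)) :=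
  h.cont.aemeasurable measurableSet_Icc

lemma integral_qualityLaw (φ : ℝ → ℝ) :
    ∫ x, φ x ∂(qualityLaw f) = ∫ x in Icc (0 : ℝ) 1, f x * φ x := by
  rw [qualityLaw, integral_withDensity_eq_integral_toReal_smul₀ h.aemeasurable_f.ennreal_ofReal
    (by simp)]
  refine setIntegral_congr_fun measurableSet_Icc fun x hx => ?_
  simp [ENNReal.toReal_ofReal (h.f_nonneg hx)]

omit h in
lemma qualityLaw_absolutelyContinuous : qualityLaw f ≪ volume.restrict (Icc (0 : ℝ) 1) :=
  withDensity_absolutelyContinuous _ _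

omit h in
lemma ae_mem_Icc : ∀ᵐ x ∂(qualityLaw f), x ∈ Icc (0 : ℝ) 1 :=
  qualityLaw_absolutelyContinuous.ae_le (ae_restrict_mem measurableSet_Icc)

lemma isProbabilityMeasure_qualityLaw : IsProbabilityMeasure (qualityLaw f) := by
  constructor
  rw [qualityLaw, withDensity_apply _ MeasurableSet.univ, Measure.restrict_univ,
    ← ofReal_integral_eq_lintegral_ofReal h.cont.integrableOn_Icc
      (ae_restrict_of_forall_mem measurableSet_Icc fun x hx => h.f_nonneg hx),
    integral_Icc_eq_integral_Ioc, ← intervalIntegral.integral_of_le zero_le_one, h.int]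
  simp

omit h in
lemma ae_ne (x : ℝ) : ∀ᵐ y ∂(qualityLaw f), y ≠ x := by
  refine qualityLaw_absolutelyContinuous.ae_le (ae_restrict_of_ae ?_)
  simp [ae_iff]

end Primitives

/-! ### The concave hull of a Lipschitz function -/

section Hull

variable {G : ℝ → ℝ} {K : ℝ}

lemma mem_hull_bound {a c : ℝ} (hac : ∀ s ∈ Icc (0 : ℝ) 1, G s ≤ a + c * s) {z : ℝ × ℝ}
    (hz : z ∈ convexHull ℝ {z : ℝ × ℝ | z.1 ∈ Icc (0 : ℝ) 1 ∧ z.2 ≤ G z.1}) :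
    z.2 ≤ a + c * z.1 := by
  have hconv : Convex ℝ {z : ℝ × ℝ | z.2 ≤ a + c * z.1} := by
    intro z hz w hw α β hα hβ hαβ
    simp only [mem_ofPred_eq, Prod.snd_add, Prod.smul_snd, smul_eq_mul, Prod.fst_add,
      Prod.smul_fst] at hz hw ⊢
    have h1 := mul_le_mul_of_nonneg_left hz hα
    have h2 := mul_le_mul_of_nonneg_left hw hβ
    have h3 : α * (a + c * z.1) + β * (a + c * w.1)
        = (α + β) * a + c * (α * z.1 + β * w.1) := by ring
    rw [hαβ, one_mul] at h3
    linarith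
  exact convexHull_min (t := {z : ℝ × ℝ | z.2 ≤ a + c * z.1})
    (fun w hw => hw.2.trans (hac _ hw.1)) hconv hz

lemma mem_hull_of_mem {s : ℝ} (hs : s ∈ Icc (0 : ℝ) 1) :
    (s, G s) ∈ convexHull ℝ {z : ℝ × ℝ | z.1 ∈ Icc (0 : ℝ) 1 ∧ z.2 ≤ G z.1} :=
  subset_convexHull _ _ ⟨hs, le_rfl⟩

/-- Every affine majorant of `G` lies above the concave hull. -/
lemma concaveHull_le {a c : ℝ} (hac : ∀ s ∈ Icc (0 : ℝ) 1, G s ≤ a + c * s) {s : ℝ}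
    (hs : s ∈ Icc (0 : ℝ) 1) : concaveHull G s ≤ a + c * s :=
  csSup_le ⟨_, mem_hull_of_mem hs⟩ fun _ hy => mem_hull_bound hac hy

variable (hG : ∀ s ∈ Icc (0 : ℝ) 1, ∀ t ∈ Icc (0 : ℝ) 1, |G t - G s| ≤ K * |t - s|)
include hG

lemma le_left_line {s : ℝ} (hs : s ∈ Icc (0 : ℝ) 1) : G s ≤ G 0 + K * s := by
  have := (abs_le.1 (hG 0 (by simp) s hs)).2
  rw [sub_zero, abs_of_nonneg hs.1] at this
  linarith

lemma le_right_line {s : ℝ} (hs : s ∈ Icc (0 : ℝ) 1) : G s ≤ (G 1 + K) + (-K) * s := by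
  have := (abs_le.1 (hG 1 (by simp) s hs)).2
  rw [abs_of_nonpos (by linarith [hs.2])] at this
  linarith

lemma bddAbove_hull (s : ℝ) :
    BddAbove {y : ℝ | (s, y) ∈ convexHull ℝ {z : ℝ × ℝ | z.1 ∈ Icc (0 : ℝ) 1 ∧ z.2 ≤ G z.1}} :=
  ⟨G 0 + K * s, fun _ hy => mem_hull_bound (fun _ ht => le_left_line hG ht) hy⟩

lemma le_concaveHull {s : ℝ} (hs : s ∈ Icc (0 : ℝ) 1) : G s ≤ concaveHull G s :=
  le_csSup (bddAbove_hull hG s) (mem_hull_of_mem hs)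

lemma concaveOn_concaveHull : ConcaveOn ℝ (Icc 0 1) (concaveHull G) := by
  refine ⟨convex_Icc 0 1, fun x hx y hy α β hα hβ hαβ => ?_⟩
  refine le_of_forall_pos_le_add fun ε hε => ?_
  obtain ⟨u, hu, hu'⟩ := exists_lt_of_lt_csSup ⟨G x, mem_hull_of_mem hx⟩
    (sub_lt_self (concaveHull G x) hε)
  obtain ⟨w, hw, hw'⟩ := exists_lt_of_lt_csSup ⟨G y, mem_hull_of_mem hy⟩
    (sub_lt_self (concaveHull G y) hε)
  have hmem := convex_convexHull ℝ _ hu hw hα hβ hαβ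
  have := le_csSup (bddAbove_hull hG (α • x + β • y))
    hmem
  change _ ≤ concaveHull G (α • x + β • y) at this
  simp only [smul_eq_mul, Prod.smul_snd] at this ⊢
  have h1 := mul_le_mul_of_nonneg_left hu'.le hα
  have h2 := mul_le_mul_of_nonneg_left hw'.le hβ
  have h3 : α * (concaveHull G x - ε) + β * (concaveHull G y - ε)
      = α * concaveHull G x + β * concaveHull G y - (α + β) * ε := by ring
  rw [hαβ, one_mul] at h3
  linarith

lemma concaveHull_zero : concaveHull G 0 = G 0 := by
  refine le_antisymm ?_ (le_concaveHull hG (by simp))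
  have := concaveHull_le (fun _ ht => le_left_line hG ht) (s := 0) (by simp)
  simpa using this

lemma concaveHull_one : concaveHull G 1 = G 1 := by
  refine le_antisymm ?_ (le_concaveHull hG (by simp))
  have := concaveHull_le (fun _ ht => le_right_line hG ht) (s := 1) (by simp)
  simpa using this

lemma abs_concaveHull_sub_le {s t : ℝ} (hs : s ∈ Icc (0 : ℝ) 1) (ht : t ∈ Icc (0 : ℝ) 1) :
    |concaveHull G t - concaveHull G s| ≤ K * |t - s| := by
  wlog hst : s ≤ t generalizing s t
  · rw [abs_sub_comm, abs_sub_comm t]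
    exact this ht hs (le_of_not_ge hst)
  rcases hst.eq_or_lt with rfl | hlt
  · simp
  have hc := concaveOn_concaveHull hG
  rw [abs_of_nonneg (sub_nonneg.2 hst), abs_le]
  constructor
  · have h1 := concaveHull_le (fun _ ht => le_right_line hG ht) hs
    have h2 := concaveHull_one hG
    rcases ht.2.eq_or_lt with rfl | ht1
    · linarith
    · have := hc.slope_anti_adjacent hs (y := t) (z := 1) (by simp) hlt ht1
      have h3 := concaveHull_le (fun _ ht => le_right_line hG ht) ht
      rw [div_le_div_iff₀ (by linarith) (by linarith)] at this
      by_contra hcon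
      push Not at hcon
      nlinarith
  · have h1 := concaveHull_le (fun _ ht => le_left_line hG ht) ht
    have h2 := concaveHull_zero hG
    rcases hs.1.eq_or_lt with rfl | hs0
    · linarith
    · have := hc.slope_anti_adjacent (x := 0) (y := s) (by simp) ht hs0 hlt
      have h3 := concaveHull_le (fun _ ht => le_left_line hG ht) hs
      rw [div_le_div_iff₀ (by linarith) (by linarith)] at this
      by_contra hcon
      push Not at hcon
      nlinarith

lemma continuousOn_concaveHull : ContinuousOn (concaveHull G) (Icc 0 1) := by
  refine LipschitzOnWith.continuousOn (K := K.toNNReal)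
    (LipschitzOnWith.of_dist_le_mul fun x hx y hy => ?_)
  rw [Real.dist_eq, Real.dist_eq]
  exact (abs_concaveHull_sub_le hG hy hx).trans
    (mul_le_mul_of_nonneg_right (Real.le_coe_toNNReal K) (abs_nonneg _))

lemma continuousOn_of_lip : ContinuousOn G (Icc 0 1) := by
  refine LipschitzOnWith.continuousOn (K := K.toNNReal)
    (LipschitzOnWith.of_dist_le_mul fun x hx y hy => ?_)
  rw [Real.dist_eq, Real.dist_eq]
  exact (hG y hy x hx).trans
    (mul_le_mul_of_nonneg_right (Real.le_coe_toNNReal K) (abs_nonneg _))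

omit hG in
/-- The right derivative of a concave function on `[0,1]` is a supergradient. -/
lemma le_tangent {H : ℝ → ℝ} (hc : ConcaveOn ℝ (Icc 0 1) H) {x y : ℝ} (hx : x ∈ Ioo (0 : ℝ) 1)
    (hy : y ∈ Icc (0 : ℝ) 1) : H y ≤ H x + derivWithin H (Ioi x) x * (y - x) := by
  have hxi : x ∈ interior (Icc (0 : ℝ) 1) := by rwa [interior_Icc]
  have hneg := hc.neg
  have hr := hneg.hasDerivWithinAt_rightDeriv_of_mem_interior hxi
  have hd : derivWithin (-H) (Ioi x) x = -derivWithin H (Ioi x) x := derivWithin.neg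
  rcases lt_trichotomy x y with hlt | rfl | hlt
  · have h1 := hneg.rightDeriv_le_slope_of_mem_interior hxi hy hlt
    rw [hd, slope_def_field, le_div_iff₀ (by linarith)] at h1
    simp only [Pi.neg_apply] at h1
    linarith
  · simp
  · have h1 := hneg.slope_le_leftDeriv_of_mem_interior hy hxi hlt
    have h2 := hneg.leftDeriv_le_rightDeriv_of_mem_interior hxi
    have h3 := h1.trans h2
    rw [hd, slope_def_field, div_le_iff₀ (by linarith)] at h3
    simp only [Pi.neg_apply] at h3
    linarith

omit hG in
lemma hasDerivWithinAt_right {H : ℝ → ℝ} (hc : ConcaveOn ℝ (Icc 0 1) H) {x : ℝ}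
    (hx : x ∈ Ioo (0 : ℝ) 1) : HasDerivWithinAt H (derivWithin H (Ioi x) x) (Ioi x) x := by
  have hxi : x ∈ interior (Icc (0 : ℝ) 1) := by rwa [interior_Icc]
  have := (hc.neg.hasDerivWithinAt_rightDeriv_of_mem_interior hxi).neg
  rw [neg_neg] at this
  exact this.differentiableWithinAt.hasDerivWithinAt

omit hG in
lemma antitoneOn_rightDeriv {H : ℝ → ℝ} (hc : ConcaveOn ℝ (Icc 0 1) H) :
    AntitoneOn (fun x => derivWithin H (Ioi x) x) (Ioo 0 1) := by
  intro x hx y hy hxy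
  rcases hxy.eq_or_lt with rfl | hlt
  · exact le_rfl
  have h1 := le_tangent hc hx (Ioo_subset_Icc_self hy)
  have h2 := le_tangent hc hy (Ioo_subset_Icc_self hx)
  by_contra hcon
  push Not at hcon
  nlinarith

lemma abs_rightDeriv_concaveHull_le {x : ℝ} (hx : x ∈ Ioo (0 : ℝ) 1) :
    |derivWithin (concaveHull G) (Ioi x) x| ≤ K := by
  have hc := concaveOn_concaveHull hG
  have h0 := le_tangent hc hx (y := 0) (by simp)
  have h1 := le_tangent hc hx (y := 1) (by simp)
  have l0 := concaveHull_le (fun _ ht => le_left_line hG ht) (Ioo_subset_Icc_self hx)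
  have l1 := concaveHull_le (fun _ ht => le_right_line hG ht) (Ioo_subset_Icc_self hx)
  rw [concaveHull_zero hG] at h0
  rw [concaveHull_one hG] at h1
  obtain ⟨hx0, hx1⟩ := hx
  rw [abs_le]
  constructor
  · by_contra hcon
    push Not at hcon
    nlinarith
  · by_contra hcon
    push Not at hcon
    nlinarith

/-- A supporting line of the concave hull at `x` meets the graph of `G` on either side of `x`
(`σ = 1`: on the left, `σ = -1`: on the right). Otherwise, tilting the line around a point slightly
beyond `x` would give an affine majorant of `G` that passes below the hull at `x`. -/
lemma exists_contact {x m σ : ℝ} (hx : x ∈ Icc (0 : ℝ) 1) (hσ : σ = 1 ∨ σ = -1)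
    (hm : ∀ t ∈ Icc (0 : ℝ) 1, concaveHull G t ≤ concaveHull G x + m * (t - x)) :
    ∃ t ∈ Icc (0 : ℝ) 1, σ * (t - x) ≤ 0 ∧ concaveHull G x + m * (t - x) ≤ G t := by
  by_contra hcon
  push Not at hcon
  have hcont := continuousOn_of_lip hG
  obtain ⟨t₀, ⟨ht₀, ht₀x⟩, hmin⟩ :=
    (isCompact_Icc.inter_right (t := {t | σ * (t - x) ≤ 0})
      (isClosed_le (by fun_prop) continuous_const)).exists_isMinOn (s := Icc (0 : ℝ) 1 ∩ _)
      (f := fun t => concaveHull G x + m * (t - x) - G t) ⟨x, hx, by simp⟩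
      (ContinuousOn.mono (by fun_prop) inter_subset_left)
  set ε := concaveHull G x + m * (t₀ - x) - G t₀ with hε_def
  have hε : 0 < ε := sub_pos.2 (hcon t₀ ht₀ ht₀x)
  have hmin' : ∀ t ∈ Icc (0 : ℝ) 1, σ * (t - x) ≤ 0 →
      ε ≤ concaveHull G x + m * (t - x) - G t := fun t ht ht' => hmin ⟨ht, ht'⟩
  have hKm : 0 < |m| + |K| + 1 := by positivity
  obtain ⟨δ, hδ, hδ1, hδε⟩ : ∃ δ : ℝ, 0 < δ ∧ δ ≤ 1 ∧ (|m| + |K| + 1) * δ ≤ ε / 2 := by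
    refine ⟨min 1 (ε / 2 / (|m| + |K| + 1)), by positivity, min_le_left _ _, ?_⟩
    calc _ ≤ (|m| + |K| + 1) * (ε / 2 / (|m| + |K| + 1)) :=
          mul_le_mul_of_nonneg_left (min_le_right _ _) hKm.le
      _ = ε / 2 := by field_simp
  -- within distance `δ` of the compact side, the gap to the line is still at least `ε / 2`
  have hgap : ∀ t ∈ Icc (0 : ℝ) 1, σ * (t - x) ≤ δ →
      ε / 2 ≤ concaveHull G x + m * (t - x) - G t := by
    intro t ht htδ
    rcases le_or_gt (σ * (t - x)) 0 with h0 | h0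
    · linarith [hmin' t ht h0]
    · have habs : |t - x| ≤ δ := by
        rcases hσ with rfl | rfl
        · rw [abs_of_pos (by linarith)]; linarith
        · rw [abs_of_neg (by linarith)]; linarith
      have h1 := (abs_le.1 (hG x hx t ht)).2
      have h2 := hmin' x hx (by simp)
      have h3 : |m * (t - x)| ≤ |m| * δ := by
        rw [abs_mul]; exact mul_le_mul_of_nonneg_left habs (abs_nonneg _)
      have h4 : K * |t - x| ≤ |K| * δ :=
        mul_le_mul (le_abs_self K) habs (abs_nonneg _) (abs_nonneg _)
      have h5 := (abs_le.1 h3).1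
      simp only [sub_self, mul_zero, add_zero] at h2
      nlinarith
  have hmaj : ∀ t ∈ Icc (0 : ℝ) 1,
      G t ≤ (concaveHull G x - m * x - ε / 4 * (σ * x + δ)) + (m + ε / 4 * σ) * t := by
    intro t ht
    rcases le_or_gt (σ * (t - x)) δ with h0 | h0
    · have h1 := hgap t ht h0
      have h2 : -1 ≤ σ * (t - x) := by
        rcases hσ with rfl | rfl <;> linarith [ht.1, ht.2, hx.1, hx.2]
      nlinarith
    · have h1 := (le_concaveHull hG ht).trans (hm t ht)
      nlinarith
  have := concaveHull_le hmaj hx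
  nlinarith

/-- Around every point, the concave hull is affine up to points of contact with `G` on both
sides. -/
lemma exists_affine_contact {x : ℝ} (hx : x ∈ Ioo (0 : ℝ) 1) :
    ∃ y ∈ Icc 0 x, ∃ z ∈ Icc x 1, concaveHull G y = G y ∧ concaveHull G z = G z ∧
      ∃ a c : ℝ, ∀ t ∈ Icc y z, concaveHull G t = a + c * t := by
  have hxI := Ioo_subset_Icc_self hx
  have hc := concaveOn_concaveHull hG
  set m := derivWithin (concaveHull G) (Ioi x) x
  have hm : ∀ t ∈ Icc (0 : ℝ) 1, concaveHull G t ≤ concaveHull G x + m * (t - x) :=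
    fun t ht => le_tangent hc hx ht
  obtain ⟨y, hy, hyx, hyG⟩ := exists_contact hG hxI (Or.inl rfl) hm
  obtain ⟨z, hz, hzx, hzG⟩ := exists_contact hG hxI (Or.inr rfl) hm
  have hy1 := le_concaveHull hG hy
  have hz1 := le_concaveHull hG hz
  have hy2 := hm y hy
  have hz2 := hm z hz
  refine ⟨y, ⟨hy.1, by linarith⟩, z, ⟨by linarith, hz.2⟩, by linarith, by linarith,
    concaveHull G x - m * x, m, fun t ht => le_antisymm ?_ ?_⟩
  · linarith [hm t ⟨hy.1.trans ht.1, ht.2.trans hz.2⟩]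
  · rcases (ht.1.trans ht.2).eq_or_lt with hyz | hyz
    · have : t = y := le_antisymm (hyz ▸ ht.2) ht.1
      subst this
      linarith
    · have h0 : (z - t) / (z - y) + (t - y) / (z - y) = 1 := by
        rw [← add_div, div_eq_one_iff_eq (by linarith)]; ring
      have h1 := hc.2 hy hz (div_nonneg (by linarith [ht.2]) (by linarith))
        (div_nonneg (by linarith [ht.1]) (by linarith)) h0
      have hzy : z - y ≠ 0 := by linarith
      have h2 : (z - t) / (z - y) * y + (t - y) / (z - y) * z = t := by field_simp; ring
      simp only [smul_eq_mul, h2] at h1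
      have hyv : concaveHull G y = concaveHull G x + m * (y - x) := by linarith
      have hzv : concaveHull G z = concaveHull G x + m * (z - x) := by linarith
      rw [hyv, hzv] at h1
      have h3 : (z - t) / (z - y) * (concaveHull G x + m * (y - x)) +
          (t - y) / (z - y) * (concaveHull G x + m * (z - x))
          = concaveHull G x - m * x + m * t := by field_simp; ring
      linarith

end Hull

/-! ### Gaps between a function and its concave hull -/

section Gaps

/-- `c = (c.1, c.2)` is a gap of `G`: a maximal open interval on which `G` lies strictly below its
concave hull. -/
structure IsGap (G : ℝ → ℝ) (c : ℝ × ℝ) : Prop where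
  nonneg : 0 ≤ c.1
  lt : c.1 < c.2
  le_one : c.2 ≤ 1
  left : concaveHull G c.1 = G c.1
  right : concaveHull G c.2 = G c.2
  gap : ∀ t ∈ Ioo c.1 c.2, G t < concaveHull G t

variable {G k : ℝ → ℝ} {K : ℝ}

lemma IsGap.eq_of_mem {c d : ℝ × ℝ} (hc : IsGap G c) (hd : IsGap G d) {x : ℝ}
    (hxc : x ∈ Ioo c.1 c.2) (hxd : x ∈ Ioo d.1 d.2) : c = d := by
  have h1 : ∀ {c d : ℝ × ℝ}, IsGap G c → IsGap G d → x ∈ Ioo c.1 c.2 → x ∈ Ioo d.1 d.2 →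
      d.1 ≤ c.1 ∧ c.2 ≤ d.2 := by
    intro c d hc hd hxc hxd
    constructor
    · by_contra hlt
      push Not at hlt
      exact (hc.gap d.1 ⟨hlt, hxd.1.trans hxc.2⟩).ne' hd.left
    · by_contra hlt
      push Not at hlt
      exact (hc.gap d.2 ⟨hxc.1.trans hxd.2, hlt⟩).ne' hd.right
  have a := h1 hc hd hxc hxd
  have b := h1 hd hc hxd hxc
  exact Prod.ext (le_antisymm b.1 a.1) (le_antisymm a.2 b.2)

lemma IsGap.disjoint {c d : ℝ × ℝ} (hc : IsGap G c) (hd : IsGap G d) (hne : c ≠ d) :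
    c.2 ≤ d.1 ∨ d.2 ≤ c.1 := by
  by_contra hcon
  push Not at hcon
  obtain ⟨x, h1, h2⟩ := exists_between
    (show max c.1 d.1 < min c.2 d.2 by simp [hc.lt, hd.lt, hcon.1, hcon.2])
  rw [max_lt_iff] at h1
  rw [lt_min_iff] at h2
  exact hne (hc.eq_of_mem hd ⟨h1.1, h2.1⟩ ⟨h1.2, h2.2⟩)

variable (hG : ∀ s ∈ Icc (0 : ℝ) 1, ∀ t ∈ Icc (0 : ℝ) 1, |G t - G s| ≤ K * |t - s|)
include hG

lemma IsGap.affine {c : ℝ × ℝ} (hc : IsGap G c) :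
    ∃ a m : ℝ, ∀ t ∈ Icc c.1 c.2, concaveHull G t = a + m * t := by
  obtain ⟨x, hx1, hx2⟩ := exists_between hc.lt
  obtain ⟨y, hy, z, hz, hyG, hzG, a, m, h⟩ := exists_affine_contact hG (x := x)
    ⟨hc.nonneg.trans_lt hx1, hx2.trans_le hc.le_one⟩
  refine ⟨a, m, fun t ht => h t ⟨le_trans ?_ ht.1, ht.2.trans ?_⟩⟩
  · by_contra hlt
    push Not at hlt
    exact (hc.gap y ⟨hlt, hy.2.trans_lt hx2⟩).ne' hyG
  · by_contra hlt
    push Not at hlt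
    exact (hc.gap z ⟨hx1.trans_le hz.1, hlt⟩).ne' hzG

lemma exists_isGap {s : ℝ} (hs : s ∈ Icc (0 : ℝ) 1) (hlt : G s < concaveHull G s) :
    ∃ c, IsGap G c ∧ s ∈ Ioo c.1 c.2 := by
  have hcl : IsClosed {t ∈ Icc (0 : ℝ) 1 | concaveHull G t = G t} := by
    have := ((continuousOn_concaveHull hG).sub (continuousOn_of_lip hG)).preimage_isClosed_of_isClosed
      isClosed_Icc (isClosed_singleton (x := (0 : ℝ)))
    convert this using 1
    ext t
    simp [sub_eq_zero]
  obtain ⟨a, ⟨⟨haI, haG⟩, has⟩, ha⟩ := ((isCompact_Icc (a := (0 : ℝ)) (b := s)).inter_left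
    hcl).exists_isGreatest ⟨0, ⟨by simp, concaveHull_zero hG⟩, by simp [hs.1]⟩
  obtain ⟨b, ⟨⟨hbI, hbG⟩, hbs⟩, hb⟩ := ((isCompact_Icc (a := s) (b := 1)).inter_left
    hcl).exists_isLeast ⟨1, ⟨by simp, concaveHull_one hG⟩, by simp [hs.2]⟩
  have has' : a < s := lt_of_le_of_ne has.2 (by rintro rfl; exact hlt.ne' haG)
  have hbs' : s < b := lt_of_le_of_ne hbs.1 (by rintro rfl; exact hlt.ne' hbG)
  refine ⟨(a, b), ⟨haI.1, has'.trans hbs', hbI.2, haG, hbG, fun t ht => ?_⟩, has', hbs'⟩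
  have htI : t ∈ Icc (0 : ℝ) 1 := ⟨haI.1.trans ht.1.le, ht.2.le.trans hbI.2⟩
  refine lt_of_le_of_ne (le_concaveHull hG htI) fun heq => ?_
  rcases le_total t s with hts | hts
  · exact ht.1.not_ge (ha ⟨⟨htI, heq.symm⟩, htI.1, hts⟩)
  · exact ht.2.not_ge (hb ⟨⟨htI, heq.symm⟩, hts, htI.2⟩)

variable (hk : ∀ s ∈ Ioo (0 : ℝ) 1, HasDerivAt G (k s) s)
include hk

lemma IsGap.not_antitoneOn {c : ℝ × ℝ} (hc : IsGap G c) : ¬ AntitoneOn k (Ioo c.1 c.2) := by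
  intro hanti
  have hsub : Ioo c.1 c.2 ⊆ Ioo 0 1 := Ioo_subset_Ioo hc.nonneg hc.le_one
  have hcont : ContinuousOn G (Icc c.1 c.2) :=
    (continuousOn_of_lip hG).mono (Icc_subset_Icc hc.nonneg hc.le_one)
  have hconc : ConcaveOn ℝ (Icc c.1 c.2) G := by
    refine AntitoneOn.concaveOn_of_deriv (convex_Icc _ _) hcont ?_ ?_
    · rw [interior_Icc]
      exact fun t ht => (hk t (hsub ht)).differentiableAt.differentiableWithinAt
    · rw [interior_Icc]
      exact hanti.congr fun t ht => ((hk t (hsub ht)).deriv).symm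
  obtain ⟨a, m, ham⟩ := hc.affine hG
  have hlt := hc.lt
  have h1 := hconc.2 (left_mem_Icc.2 hlt.le) (right_mem_Icc.2 hlt.le)
    (show (0 : ℝ) ≤ 1 / 2 by norm_num) (show (0 : ℝ) ≤ 1 / 2 by norm_num) (by norm_num)
  simp only [smul_eq_mul] at h1
  have h2 := hc.gap (1 / 2 * c.1 + 1 / 2 * c.2) ⟨by linarith, by linarith⟩
  rw [ham _ ⟨by linarith, by linarith⟩] at h2
  have h3 := ham c.1 (left_mem_Icc.2 hlt.le)
  have h4 := ham c.2 (right_mem_Icc.2 hlt.le)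
  rw [hc.left] at h3
  rw [hc.right] at h4
  rw [h3, h4] at h1
  linarith

lemma IsGap.not_monotoneOn {c d : ℝ × ℝ} (hc : IsGap G c) (hd : IsGap G d) (hcd : c.2 ≤ d.1) :
    ¬ MonotoneOn k (Ioo c.1 d.2) := by
  intro hmono
  have hsub : Ioo c.1 d.2 ⊆ Ioo 0 1 := Ioo_subset_Ioo hc.nonneg hd.le_one
  have hsub' : Icc c.1 d.2 ⊆ Icc 0 1 := Icc_subset_Icc hc.nonneg hd.le_one
  have hconv : ConvexOn ℝ (Icc c.1 d.2) G := by
    refine MonotoneOn.convexOn_of_deriv (convex_Icc _ _) ((continuousOn_of_lip hG).mono hsub') ?_ ?_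
    · rw [interior_Icc]
      exact fun t ht => (hk t (hsub ht)).differentiableAt.differentiableWithinAt
    · rw [interior_Icc]
      exact hmono.congr fun t ht => ((hk t (hsub ht)).deriv).symm
  have hD := ((concaveOn_concaveHull hG).subset hsub' (convex_Icc _ _)).sub hconv
  obtain ⟨x, hx1, hx2⟩ := exists_between hc.lt
  obtain ⟨y, hy1, hy2⟩ := exists_between hd.lt
  have hcl := hc.lt
  have hdl := hd.lt
  have := hD.min_le_of_mem_Icc (x := x) (y := y) (z := c.2) ⟨by linarith, by linarith⟩
    ⟨by linarith, by linarith⟩ ⟨by linarith, by linarith⟩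
  have hx := hc.gap x ⟨hx1, hx2⟩
  have hy := hd.gap y ⟨hy1, hy2⟩
  simp only [Pi.sub_apply, hc.right, sub_self, min_le_iff] at this
  rcases this with h | h <;> linarith

/-- If the derivative of `G` is piecewise monotone, there are finitely many gaps: where the
derivative is decreasing, `G` is concave and there is no complete gap; where it is increasing, the
distance to the hull is concave, so there is at most one. All other gaps contain an endpoint of one
of the pieces. -/
lemma finite_isGap {parts : Set (Set ℝ)} (hfin : parts.Finite) (hcov : Icc (0 : ℝ) 1 ⊆ ⋃₀ parts)
    (hsub : ∀ I ∈ parts, I ⊆ Icc 0 1)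
    (hparts : ∀ I ∈ parts, I.OrdConnected ∧ (MonotoneOn k I ∨ AntitoneOn k I)) :
    {c | IsGap G c}.Finite := by
  have hpt : ∀ x : ℝ, {c | IsGap G c ∧ x ∈ Ioo c.1 c.2}.Finite := fun x =>
    Set.Subsingleton.finite fun c hc d hd => hc.1.eq_of_mem hd.1 hc.2 hd.2
  have hin : ∀ I ∈ parts, {c | IsGap G c ∧ Ioo c.1 c.2 ⊆ I}.Finite := by
    intro I hI
    refine Set.Subsingleton.finite fun c hc d hd => ?_
    obtain ⟨hconn, hmono | hanti⟩ := hparts I hI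
    · have key : ∀ {c d : ℝ × ℝ}, (IsGap G c ∧ Ioo c.1 c.2 ⊆ I) → (IsGap G d ∧ Ioo d.1 d.2 ⊆ I) →
          c.2 ≤ d.1 → False := by
        intro c d hc hd hcd
        refine hc.1.not_monotoneOn hG hk hd.1 hcd (hmono.mono fun t ht => ?_)
        obtain ⟨x, hx1, hx2⟩ := exists_between (lt_min hc.1.lt ht.1)
        obtain ⟨y, hy1, hy2⟩ := exists_between (max_lt hd.1.lt ht.2)
        rw [lt_min_iff] at hx2
        rw [max_lt_iff] at hy1
        exact hconn.out (hc.2 ⟨hx1, hx2.1⟩) (hd.2 ⟨hy1.1, hy2⟩) ⟨hx2.2.le, hy1.2.le⟩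
      by_contra hne
      rcases hc.1.disjoint hd.1 hne with h | h
      · exact key hc hd h
      · exact key hd hc h
    · exact (hc.1.not_antitoneOn hG hk (hanti.mono hc.2)).elim
  refine (hfin.biUnion fun I hI =>
    ((hin I hI).union (hpt (sSup I))).union (hpt (sInf I))).subset fun c hc => ?_
  obtain ⟨m, hm1, hm2⟩ := exists_between (IsGap.lt hc)
  obtain ⟨I, hI, hmI⟩ := hcov (show m ∈ Icc (0 : ℝ) 1 from
    ⟨(IsGap.nonneg hc).trans hm1.le, hm2.le.trans (IsGap.le_one hc)⟩)
  simp only [mem_iUnion]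
  refine ⟨I, hI, ?_⟩
  have hconn := (hparts I hI).1
  have hbA : BddAbove I := bddAbove_Icc.mono (hsub I hI)
  have hbB : BddBelow I := bddBelow_Icc.mono (hsub I hI)
  by_cases hcI : Ioo c.1 c.2 ⊆ I
  · exact Or.inl (Or.inl ⟨hc, hcI⟩)
  obtain ⟨t, ht, htI⟩ := not_subset.1 hcI
  rcases le_total m t with hmt | hmt
  · refine Or.inl (Or.inr ⟨hc, hm1.trans_le (le_csSup hbA hmI), lt_of_le_of_lt ?_ ht.2⟩)
    refine csSup_le ⟨m, hmI⟩ fun y hy => ?_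
    by_contra hlt
    push Not at hlt
    exact htI (hconn.out hmI hy ⟨hmt, hlt.le⟩)
  · refine Or.inr ⟨hc, lt_of_lt_of_le ht.1 ?_, (csInf_le hbB hmI).trans_lt hm2⟩
    refine le_csInf ⟨m, hmI⟩ fun y hy => ?_
    by_contra hlt
    push Not at hlt
    exact htI (hconn.out hy hmI ⟨hlt.le, hmt⟩)

end Gaps

/-- Finitely many pairwise non-overlapping intervals can be listed from left to right. -/
lemma exists_enumeration (Γ : Finset (ℝ × ℝ)) (hlt : ∀ c ∈ Γ, c.1 < c.2)
    (hdisj : ∀ c ∈ Γ, ∀ d ∈ Γ, c ≠ d → c.2 ≤ d.1 ∨ d.2 ≤ c.1) :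
    ∃ (L : ℕ) (lo hi : ℕ → ℝ), (∀ i, 1 ≤ i → i ≤ L → (lo i, hi i) ∈ Γ) ∧
      (∀ i, 1 ≤ i → i < L → hi i ≤ lo (i + 1)) ∧
      ∀ c ∈ Γ, ∃ i, 1 ≤ i ∧ i ≤ L ∧ (lo i, hi i) = c := by
  induction Γ using Finset.induction_on_max_value (fun c : ℝ × ℝ => c.1) with
  | empty => exact ⟨0, 0, 0, fun i h1 h2 => by omega, fun i h1 h2 => by omega, by simp⟩
  | insert c Γ hc hmax ih =>
    obtain ⟨L, lo, hi, h1, h2, h3⟩ := ih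
      (fun d hd => hlt d (Finset.mem_insert_of_mem hd))
      (fun d hd e he => hdisj d (Finset.mem_insert_of_mem hd) e (Finset.mem_insert_of_mem he))
    have hlast : ∀ d ∈ Γ, d.2 ≤ c.1 := by
      intro d hd
      rcases hdisj c (Finset.mem_insert_self _ _) d (Finset.mem_insert_of_mem hd)
        (by rintro rfl; exact hc hd) with h | h
      · linarith [hmax d hd, hlt c (Finset.mem_insert_self _ _)]
      · exact h
    refine ⟨L + 1, Function.update lo (L + 1) c.1, Function.update hi (L + 1) c.2, ?_, ?_, ?_⟩
    · intro i hi1 hi2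
      rcases eq_or_ne i (L + 1) with rfl | hne
      · simp
      · simpa [hne] using Or.inr (h1 i hi1 (by omega))
    · intro i hi1 hi2
      rcases eq_or_ne i L with rfl | hne
      · simpa using hlast _ (h1 i hi1 le_rfl)
      · have e1 : i ≠ L + 1 := by omega
        have e2 : i + 1 ≠ L + 1 := by omega
        simpa [e1, e2, hne] using h2 i hi1 (by omega)
    · intro d hd
      rcases Finset.mem_insert.1 hd with rfl | hd
      · exact ⟨L + 1, by omega, le_rfl, by simp⟩
      · obtain ⟨i, hi1, hi2, rfl⟩ := h3 d hd
        have e1 : i ≠ L + 1 := by omega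
        exact ⟨i, hi1, by omega, by simp [e1]⟩

/-! ### Existence of pooling intervals -/

lemma ironedSurplus_eq_of_affine {f v : ℝ → ℝ} {lo hi a c : ℝ}
    (h : ∀ s ∈ Ico lo hi, ironedCumSurplus f v s = a + c * s) {s : ℝ} (hs : s ∈ Ico lo hi) :
    ironedSurplus f v s = c := by
  have h1 : HasDerivWithinAt (fun s => a + c * s) c (Ioi s) s := by
    simpa using (((hasDerivAt_id s).const_mul c).const_add a).hasDerivWithinAt
  refine (h1.congr_of_eventuallyEq ?_ (h s hs)).derivWithin (uniqueDiffWithinAt_Ioi s)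
  filter_upwards [Ioo_mem_nhdsGT hs.2] with t ht
  exact h t ⟨hs.1.trans ht.1.le, ht.2⟩

lemma bddAbove_cutoffSet (f v : ℝ → ℝ) :
    BddAbove {s : ℝ | s ∈ Ico (0 : ℝ) 1 ∧ 0 ≤ ironedSurplus f v s} :=
  ⟨1, fun _ hs => hs.1.2.le⟩

lemma exclusionCutoff_nonneg (f v : ℝ → ℝ) : 0 ≤ exclusionCutoff f v :=
  Real.sSup_nonneg fun _ hs => hs.1.1

lemma exclusionCutoff_le_one (f v : ℝ → ℝ) : exclusionCutoff f v ≤ 1 :=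
  Real.sSup_le (fun _ hs => hs.1.2.le) zero_le_one

lemma exclusionCutoff_mem (f v : ℝ → ℝ) : exclusionCutoff f v ∈ Icc (0 : ℝ) 1 :=
  ⟨exclusionCutoff_nonneg f v, exclusionCutoff_le_one f v⟩

lemma exists_lt_of_lt_exclusionCutoff {f v : ℝ → ℝ} {s : ℝ} (hs : 0 ≤ s)
    (hlt : s < exclusionCutoff f v) :
    ∃ t ∈ Ico (0 : ℝ) 1, 0 ≤ ironedSurplus f v t ∧ s < t ∧ t ≤ exclusionCutoff f v := by
  have hne : {s : ℝ | s ∈ Ico (0 : ℝ) 1 ∧ 0 ≤ ironedSurplus f v s}.Nonempty := by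
    by_contra hcon
    rw [not_nonempty_iff_eq_empty] at hcon
    rw [exclusionCutoff, hcon, Real.sSup_empty] at hlt
    exact hlt.not_ge hs
  obtain ⟨t, ht, hst⟩ := exists_lt_of_lt_csSup hne hlt
  exact ⟨t, ht.1, ht.2, hst, le_csSup (bddAbove_cutoffSet f v) ht⟩

namespace Primitives

variable {f v : ℝ → ℝ} (h : Primitives f v)
include h

lemma exists_lipschitz : ∃ K, 0 ≤ K ∧ (∀ x ∈ Icc (0 : ℝ) 1, |virtualSurplus f v x| ≤ K) ∧
    ∀ s ∈ Icc (0 : ℝ) 1, ∀ t ∈ Icc (0 : ℝ) 1,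
      |cumSurplus f v t - cumSurplus f v s| ≤ K * |t - s| := by
  obtain ⟨K, hK0, hK⟩ := h.exists_surplus_bound
  exact ⟨K, hK0, hK, fun s hs t ht => h.abs_cumSurplus_sub_le hK hs ht⟩

/-- The exclusion cutoff is not interior to a gap, because `ḡ` is constant on gaps. -/
lemma gap_le_exclusionCutoff {c : ℝ × ℝ} (hc : IsGap (cumSurplus f v) c)
    (hlt : c.1 < exclusionCutoff f v) : c.2 ≤ exclusionCutoff f v := by
  obtain ⟨K, -, -, hG⟩ := h.exists_lipschitz
  by_contra hcon
  push Not at hcon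
  obtain ⟨t, ht, ht0, hct, htS⟩ := exists_lt_of_lt_exclusionCutoff hc.nonneg hlt
  obtain ⟨a, m, ham⟩ := hc.affine hG
  have ham' : ∀ s ∈ Ico c.1 c.2, ironedCumSurplus f v s = a + m * s :=
    fun s hs => ham s (Ico_subset_Icc_self hs)
  obtain ⟨u, hu1, hu2⟩ := exists_between hcon
  rw [ironedSurplus_eq_of_affine ham' ⟨hct.le, htS.trans_lt hcon⟩] at ht0
  have hu : u ∈ {s : ℝ | s ∈ Ico (0 : ℝ) 1 ∧ 0 ≤ ironedSurplus f v s} := by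
    refine ⟨⟨(exclusionCutoff_nonneg f v).trans hu1.le, hu2.trans_le hc.le_one⟩, ?_⟩
    rwa [ironedSurplus_eq_of_affine ham' ⟨hlt.le.trans hu1.le, hu2⟩]
  exact hu1.not_ge (le_csSup (bddAbove_cutoffSet f v) hu)

lemma finite_gaps (hg : Structured (virtualSurplus f v)) :
    {c | IsGap (cumSurplus f v) c}.Finite := by
  obtain ⟨K, -, -, hG⟩ := h.exists_lipschitz
  obtain ⟨parts, hfin, -, hcov, hparts⟩ := hg
  refine finite_isGap hG (fun s hs => h.hasDerivAt_cumSurplus hs)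
    (parts := (fun I => quantile f ⁻¹' I ∩ Icc 0 1) '' parts) (hfin.image _) ?_ ?_ ?_
  · intro s hs
    obtain ⟨I, hI, hsI⟩ := hcov.ge (h.quantile_mem hs)
    exact ⟨_, mem_image_of_mem _ hI, hsI, hs⟩
  · rintro _ ⟨I, -, rfl⟩
    exact inter_subset_right
  · rintro _ ⟨I, hI, rfl⟩
    have hq := h.strictMonoOn_quantile.monotoneOn
    obtain ⟨hconn, hmono⟩ := hparts I hI
    refine ⟨⟨fun x hx y hy z hz => ?_⟩, ?_⟩
    · have hzI : z ∈ Icc (0 : ℝ) 1 := ⟨hx.2.1.trans hz.1, hz.2.trans hy.2.2⟩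
      exact ⟨hconn.out hx.1 hy.1 ⟨hq hx.2 hzI hz.1, hq hzI hy.2 hz.2⟩, hzI⟩
    · rcases hmono with hm | hm
      · exact Or.inl fun x hx y hy hxy => hm hx.1 hy.1 (hq hx.2 hy.2 hxy)
      · exact Or.inr fun x hx y hy hxy => hm hx.1 hy.1 (hq hx.2 hy.2 hxy)

theorem exists_isPooling (hg : Structured (virtualSurplus f v)) :
    ∃ (L : ℕ) (lo hi : ℕ → ℝ), IsPooling f v L lo hi := by
  obtain ⟨K, -, -, hG⟩ := h.exists_lipschitz
  have hfin : {c | IsGap (cumSurplus f v) c ∧ c.2 ≤ exclusionCutoff f v}.Finite :=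
    (h.finite_gaps hg).subset fun _ hc => hc.1
  obtain ⟨L, lo, hi, hmem, hord, hall⟩ := exists_enumeration hfin.toFinset
    (fun c hc => (hfin.mem_toFinset.1 hc).1.lt)
    (fun c hc d hd hne => (hfin.mem_toFinset.1 hc).1.disjoint (hfin.mem_toFinset.1 hd).1 hne)
  have hmem' : ∀ i, 1 ≤ i → i ≤ L → IsGap (cumSurplus f v) (lo i, hi i) ∧
      hi i ≤ exclusionCutoff f v := fun i h1 h2 => hfin.mem_toFinset.1 (hmem i h1 h2)
  refine ⟨L, lo, hi, fun i h1 h2 => (hmem' i h1 h2).1.nonneg, fun i h1 h2 => (hmem' i h1 h2).1.lt,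
    fun i h1 h2 => (hmem' i h1 h2).2, hord, fun i h1 h2 => ?_, fun s hs hout => ?_⟩
  · obtain ⟨a, c, hac⟩ := (hmem' i h1 h2).1.affine hG
    exact ⟨a, c, fun s hs => hac s (Ico_subset_Icc_self hs)⟩
  · have hsI : s ∈ Icc (0 : ℝ) 1 := ⟨hs.1, hs.2.trans (exclusionCutoff_le_one f v)⟩
    refine (le_antisymm (le_concaveHull hG hsI) (le_of_not_gt fun hlt => ?_)).symm
    obtain ⟨c, hc, hsc⟩ := exists_isGap hG hsI hlt
    obtain ⟨i, h1, h2, rfl⟩ := hall c (hfin.mem_toFinset.2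
      ⟨hc, h.gap_le_exclusionCutoff hc (hsc.1.trans_le hs.2)⟩)
    exact hout i h1 h2 hsc

end Primitives

/-! ### Integration against decreasing functions -/

/-- Layer-cake formula for a weight `φ` with values in `[0,1]`. -/
lemma integral_mul_eq_integral_superlevel {μ : Measure ℝ} [IsProbabilityMeasure μ] {h φ : ℝ → ℝ}
    (hφ : Measurable φ) (hφ01 : ∀ᵐ x ∂μ, φ x ∈ Icc (0 : ℝ) 1) (hh : Integrable h μ) :
    ∫ x, h x * φ x ∂μ = ∫ t in Ioo (0 : ℝ) 1, ∫ x in {x | t < φ x}, h x ∂μ := by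
  have hmeas : MeasurableSet {z : ℝ × ℝ | z.2 < φ z.1} :=
    measurableSet_lt measurable_snd (hφ.comp measurable_fst)
  have hint : Integrable (Function.uncurry fun x t => {t | t < φ x}.indicator (fun _ => h x) t)
      (μ.prod (volume.restrict (Ioo (0 : ℝ) 1))) := by
    refine ((hh.comp_fst (volume.restrict (Ioo (0 : ℝ) 1))).indicator hmeas).congr
      (Eventually.of_forall fun z => ?_)
    simp [indicator, Function.uncurry]
  have hswap := integral_integral_swap hint
  calc ∫ x, h x * φ x ∂μ
      = ∫ x, (∫ t in Ioo (0 : ℝ) 1, {t | t < φ x}.indicator (fun _ => h x) t) ∂μ := by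
        refine integral_congr_ae ?_
        filter_upwards [hφ01] with x hx
        have h1 : Ioo (0 : ℝ) 1 ∩ {t | t < φ x} = Ioo 0 (φ x) := by
          ext t
          simp only [mem_inter_iff, mem_Ioo, mem_ofPred_eq]
          exact ⟨fun ht => ⟨ht.1.1, ht.2⟩, fun ht => ⟨⟨ht.1, ht.2.trans_le hx.2⟩, ht.2⟩⟩
        rw [setIntegral_indicator (show MeasurableSet {t | t < φ x} from measurableSet_Iio), h1]
        simp [hx.1, mul_comm]
    _ = _ := hswap
    _ = _ := by
        refine integral_congr_ae (Eventually.of_forall fun t => ?_)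
        have : MeasurableSet {x | t < φ x} := measurableSet_lt measurable_const hφ
        simp only
        rw [← integral_indicator this]
        rfl

section Superlevel

variable {f φ : ℝ → ℝ} {A : Set ℝ}

/-- Up to a null set, the superlevel sets of a function that is decreasing on a set `A` of full
measure are initial segments of `[0,1]`. -/
lemma exists_setIntegral_superlevel (hA : A ⊆ Icc 0 1) (hAae : ∀ᵐ x ∂(qualityLaw f), x ∈ A)
    (hφ : AntitoneOn φ A) (h : ℝ → ℝ) (t : ℝ) :
    ∃ c ∈ Icc (0 : ℝ) 1,
      ∫ x in {x | t < φ x}, h x ∂(qualityLaw f) = ∫ x in Icc 0 c, h x ∂(qualityLaw f) ∧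
        (c = 0 ∨ IsLUB ({x | t < φ x} ∩ A) c) := by
  by_cases hne : ({x | t < φ x} ∩ A).Nonempty
  · have hbdd : BddAbove ({x | t < φ x} ∩ A) := bddAbove_Icc.mono (inter_subset_right.trans hA)
    have hlub := isLUB_csSup hne hbdd
    obtain ⟨y, hy⟩ := hne
    refine ⟨_, ⟨(hA hy.2).1.trans (hlub.1 hy), hlub.2 fun x hx => (hA hx.2).2⟩, ?_, Or.inr hlub⟩
    refine setIntegral_congr_set ?_
    filter_upwards [hAae, Primitives.ae_ne (f := f) (sSup ({x | t < φ x} ∩ A))] with x hxA hxne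
    refine propext ⟨fun hx => ⟨(hA hxA).1, hlub.1 ⟨hx, hxA⟩⟩, fun hx => ?_⟩
    obtain ⟨z, hz, hxz⟩ := (lt_isLUB_iff hlub).1 (lt_of_le_of_ne hx.2 hxne)
    exact lt_of_lt_of_le hz.1 (hφ hxA hz.2 hxz.le)
  · refine ⟨0, by simp, ?_, Or.inl rfl⟩
    refine setIntegral_congr_set ?_
    filter_upwards [hAae, Primitives.ae_ne (f := f) 0] with x hxA hxne
    refine propext ⟨fun hx => (hne ⟨x, hx, hxA⟩).elim, fun hx => ?_⟩
    exact (hxne (le_antisymm hx.2 hx.1)).elim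

end Superlevel

/-! ### Ironing -/

namespace Primitives

variable {f v : ℝ → ℝ} (h : Primitives f v)
include h

lemma setIntegral_qualityLaw (φ : ℝ → ℝ) {c : ℝ} (hc : c ∈ Icc (0 : ℝ) 1) :
    ∫ x in Icc 0 c, φ x ∂(qualityLaw f) = ∫ x in (0 : ℝ)..c, f x * φ x := by
  rw [← integral_indicator measurableSet_Icc, h.integral_qualityLaw,
    intervalIntegral.integral_of_le hc.1, ← integral_Icc_eq_integral_Ioc]
  have : (fun x => f x * (Icc 0 c).indicator φ x) = (Icc 0 c).indicator fun x => f x * φ x := by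
    ext x
    simp [indicator]
  rw [this, setIntegral_indicator measurableSet_Icc,
    inter_eq_self_of_subset_right (Icc_subset_Icc_right hc.2)]

lemma integrable_of_bound {φ : ℝ → ℝ} {C : ℝ}
    (hφ : AEMeasurable φ (volume.restrict (Icc (0 : ℝ) 1)))
    (hC : ∀ x ∈ Ioo (0 : ℝ) 1, |φ x| ≤ C) : Integrable φ (qualityLaw f) := by
  have := h.isProbabilityMeasure_qualityLaw
  refine Integrable.of_bound (hφ.aestronglyMeasurable.mono_ac qualityLaw_absolutelyContinuous) C ?_
  filter_upwards [ae_mem_Icc (f := f), ae_ne (f := f) 0, ae_ne (f := f) 1] with x hx h0 h1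
  exact hC x ⟨lt_of_le_of_ne hx.1 h0.symm, lt_of_le_of_ne hx.2 h1⟩

lemma integrableOn_mul_of_bound {φ : ℝ → ℝ} {C : ℝ}
    (hφ : AEMeasurable φ (volume.restrict (Icc (0 : ℝ) 1)))
    (hC : ∀ x ∈ Ioo (0 : ℝ) 1, |φ x| ≤ C) :
    IntegrableOn (fun x => f x * φ x) (Icc 0 1) := by
  refine Integrable.mul_bdd (c := C) h.cont.integrableOn_Icc hφ.aestronglyMeasurable ?_
  rw [← Measure.restrict_congr_set (Ioo_ae_eq_Icc (a := (0 : ℝ)) (b := 1))]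
  exact ae_restrict_of_forall_mem measurableSet_Ioo hC

lemma aemeasurable_virtualSurplus :
    AEMeasurable (virtualSurplus f v) (volume.restrict (Icc (0 : ℝ) 1)) :=
  h.continuousOn_virtualSurplus.aemeasurable measurableSet_Icc

lemma concaveOn_ironedCumSurplus : ConcaveOn ℝ (Icc 0 1) (ironedCumSurplus f v) := by
  obtain ⟨K, -, -, hG⟩ := h.exists_lipschitz
  exact concaveOn_concaveHull hG

lemma antitoneOn_ironedSurplus : AntitoneOn (ironedSurplus f v) (Ioo 0 1) :=
  antitoneOn_rightDeriv h.concaveOn_ironedCumSurplus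

lemma antitoneOn_ironedSurplus_cdf :
    AntitoneOn (fun x => ironedSurplus f v (cdf f x)) (Ioo 0 1) := fun _ hx _ hy hxy =>
  h.antitoneOn_ironedSurplus (h.cdf_mem_Ioo hx) (h.cdf_mem_Ioo hy)
    (h.strictMonoOn_cdf.monotoneOn (Ioo_subset_Icc_self hx) (Ioo_subset_Icc_self hy) hxy)

lemma aemeasurable_ironedSurplus_cdf :
    AEMeasurable (fun x => ironedSurplus f v (cdf f x)) (volume.restrict (Icc (0 : ℝ) 1)) := by
  rw [← Measure.restrict_congr_set (Ioo_ae_eq_Icc (a := (0 : ℝ)) (b := 1))]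
  exact aemeasurable_restrict_of_antitoneOn measurableSet_Ioo h.antitoneOn_ironedSurplus_cdf

lemma exists_bound_ironedSurplus :
    ∃ K, ∀ x ∈ Ioo (0 : ℝ) 1, |ironedSurplus f v (cdf f x)| ≤ K := by
  obtain ⟨K, -, -, hG⟩ := h.exists_lipschitz
  exact ⟨K, fun x hx => abs_rightDeriv_concaveHull_le hG (h.cdf_mem_Ioo hx)⟩

lemma integrable_virtualSurplus : Integrable (virtualSurplus f v) (qualityLaw f) := by
  obtain ⟨K, -, hK⟩ := h.exists_surplus_bound
  exact h.integrable_of_bound h.aemeasurable_virtualSurplus fun x hx => hK x (Ioo_subset_Icc_self hx)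

lemma integrable_ironedSurplus :
    Integrable (fun x => ironedSurplus f v (cdf f x)) (qualityLaw f) := by
  obtain ⟨K, hK⟩ := h.exists_bound_ironedSurplus (v := v)
  exact h.integrable_of_bound h.aemeasurable_ironedSurplus_cdf hK

lemma integrable_surplus_diff :
    Integrable (fun x => virtualSurplus f v x - ironedSurplus f v (cdf f x)) (qualityLaw f) :=
  h.integrable_virtualSurplus.sub h.integrable_ironedSurplus

lemma setIntegral_virtualSurplus {c : ℝ} (hc : c ∈ Icc (0 : ℝ) 1) :
    ∫ x in Icc 0 c, virtualSurplus f v x ∂(qualityLaw f) = cumSurplus f v (cdf f c) := by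
  obtain ⟨K, -, hK⟩ := h.exists_surplus_bound
  have hsub : Icc 0 c ⊆ Icc (0 : ℝ) 1 := Icc_subset_Icc_right hc.2
  rw [h.setIntegral_qualityLaw _ hc]
  have hftc := intervalIntegral.integral_eq_sub_of_hasDerivAt_of_le hc.1
    (f := fun x => cumSurplus f v (cdf f x)) (f' := fun x => f x * virtualSurplus f v x)
    ((h.continuousOn_cumSurplus.comp h.continuousOn_cdf fun x hx => h.cdf_mem hx).mono hsub)
    (fun x hx => ?_) ?_
  · rw [hftc, cdf_zero, cumSurplus_zero, sub_zero]
  · have hx' : x ∈ Ioo (0 : ℝ) 1 := ⟨hx.1, hx.2.trans_le hc.2⟩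
    have := (h.hasDerivAt_cumSurplus (v := v) (h.cdf_mem_Ioo hx')).comp x (h.hasDerivAt_cdf hx')
    rwa [h.quantile_cdf (Ioo_subset_Icc_self hx'), mul_comm] at this
  · rw [intervalIntegrable_iff_integrableOn_Icc_of_le hc.1]
    exact (h.integrableOn_mul_of_bound h.aemeasurable_virtualSurplus
      fun x hx => hK x (Ioo_subset_Icc_self hx)).mono_set hsub

lemma setIntegral_ironedSurplus {c : ℝ} (hc : c ∈ Icc (0 : ℝ) 1) :
    ∫ x in Icc 0 c, ironedSurplus f v (cdf f x) ∂(qualityLaw f)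
      = ironedCumSurplus f v (cdf f c) := by
  obtain ⟨K, -, -, hG⟩ := h.exists_lipschitz
  obtain ⟨C, hC⟩ := h.exists_bound_ironedSurplus (v := v)
  have hsub : Icc 0 c ⊆ Icc (0 : ℝ) 1 := Icc_subset_Icc_right hc.2
  rw [h.setIntegral_qualityLaw _ hc]
  have hftc := intervalIntegral.integral_eq_sub_of_hasDeriv_right_of_le hc.1
    (f := fun x => ironedCumSurplus f v (cdf f x))
    (f' := fun x => f x * ironedSurplus f v (cdf f x))
    (((continuousOn_concaveHull hG).comp h.continuousOn_cdf fun x hx => h.cdf_mem hx).mono hsub)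
    (fun x hx => ?_) ?_
  · rw [hftc, cdf_zero]
    have : ironedCumSurplus f v 0 = 0 := (concaveHull_zero hG).trans cumSurplus_zero
    rw [this, sub_zero]
  · have hx' : x ∈ Ioo (0 : ℝ) 1 := ⟨hx.1, hx.2.trans_le hc.2⟩
    have h1 := hasDerivWithinAt_right h.concaveOn_ironedCumSurplus (h.cdf_mem_Ioo hx')
    have h2 := (h.hasDerivAt_cdf hx').hasDerivWithinAt (s := Ioo x 1)
    have h3 := h1.comp x h2 fun y hy => h.strictMonoOn_cdf (Ioo_subset_Icc_self hx')
      ⟨hx'.1.le.trans hy.1.le, hy.2.le⟩ hy.1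
    rw [mul_comm]
    exact h3.mono_of_mem_nhdsWithin (Ioo_mem_nhdsGT hx'.2)
  · rw [intervalIntegrable_iff_integrableOn_Icc_of_le hc.1]
    exact (h.integrableOn_mul_of_bound h.aemeasurable_ironedSurplus_cdf hC).mono_set hsub

/-- The gain from replacing `g` by `ḡ` on the initial segment `[0, c]` is `Ḡ - G`. -/
lemma setIntegral_surplus_diff {c : ℝ} (hc : c ∈ Icc (0 : ℝ) 1) :
    ∫ x in Icc 0 c, (virtualSurplus f v x - ironedSurplus f v (cdf f x)) ∂(qualityLaw f)
      = cumSurplus f v (cdf f c) - ironedCumSurplus f v (cdf f c) := by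
  rw [integral_sub h.integrable_virtualSurplus.integrableOn h.integrable_ironedSurplus.integrableOn,
    h.setIntegral_virtualSurplus hc, h.setIntegral_ironedSurplus hc]

lemma integral_surplus_diff_mul_nonpos {φ : ℝ → ℝ} {A : Set ℝ} (hφm : Measurable φ)
    (hφ01 : ∀ x ∈ Icc (0 : ℝ) 1, φ x ∈ Icc (0 : ℝ) 1) (hA : A ⊆ Icc 0 1)
    (hAae : ∀ᵐ x ∂(qualityLaw f), x ∈ A) (hφ : AntitoneOn φ A) :
    ∫ x, (virtualSurplus f v x - ironedSurplus f v (cdf f x)) * φ x ∂(qualityLaw f) ≤ 0 := by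
  have := h.isProbabilityMeasure_qualityLaw
  obtain ⟨K, -, -, hG⟩ := h.exists_lipschitz
  rw [integral_mul_eq_integral_superlevel hφm (ae_mem_Icc.mono hφ01)
    h.integrable_surplus_diff]
  refine integral_nonpos fun t => ?_
  obtain ⟨c, hc, heq, -⟩ := exists_setIntegral_superlevel hA hAae hφ
    (fun x => virtualSurplus f v x - ironedSurplus f v (cdf f x)) t
  simp only [Pi.zero_apply]
  rw [heq, h.setIntegral_surplus_diff hc]
  exact sub_nonpos.2 (le_concaveHull hG (h.cdf_mem hc))

lemma integral_surplus_diff_mul_eq_zero {φ : ℝ → ℝ} (hφm : Measurable φ)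
    (hφ01 : ∀ x ∈ Icc (0 : ℝ) 1, φ x ∈ Icc (0 : ℝ) 1) (hφ : AntitoneOn φ (Icc 0 1))
    (hlevel : ∀ t ∈ Ioo (0 : ℝ) 1, ∀ c ∈ Icc (0 : ℝ) 1, IsLUB ({x | t < φ x} ∩ Icc 0 1) c →
      ironedCumSurplus f v (cdf f c) = cumSurplus f v (cdf f c)) :
    ∫ x, (virtualSurplus f v x - ironedSurplus f v (cdf f x)) * φ x ∂(qualityLaw f) = 0 := by
  have := h.isProbabilityMeasure_qualityLaw
  obtain ⟨K, -, -, hG⟩ := h.exists_lipschitz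
  rw [integral_mul_eq_integral_superlevel hφm (ae_mem_Icc.mono hφ01)
    h.integrable_surplus_diff]
  refine setIntegral_eq_zero_of_forall_eq_zero fun t ht => ?_
  obtain ⟨c, hc, heq, hlub⟩ := exists_setIntegral_superlevel subset_rfl ae_mem_Icc hφ
    (fun x => virtualSurplus f v x - ironedSurplus f v (cdf f x)) t
  rw [heq, h.setIntegral_surplus_diff hc]
  rcases hlub with rfl | hlub
  · rw [cdf_zero]
    exact sub_eq_zero.2 (concaveHull_zero hG).symm
  · exact sub_eq_zero.2 (hlevel t ht c hc hlub).symm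

end Primitives

/-! ### The envelope formula -/

section Envelope

/-- The best payoff `sup_r (T r - x * P r)` of a seller of quality `x`. -/
def indirectUtility (P T : ℝ → ℝ) (x : ℝ) : ℝ := sSup ((fun r => T r - x * P r) '' Icc 0 1)

variable {P T : ℝ → ℝ} {A : Set ℝ}

lemma bddAbove_payoffs (hP : ∀ r ∈ Icc (0 : ℝ) 1, P r ∈ Icc (0 : ℝ) 1) {x₀ : ℝ}
    (hIC : ∀ r ∈ Icc (0 : ℝ) 1, T r - x₀ * P r ≤ T x₀ - x₀ * P x₀) (x : ℝ) :
    BddAbove ((fun r => T r - x * P r) '' Icc 0 1) := by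
  refine ⟨T x₀ - x₀ * P x₀ + |x₀ - x|, ?_⟩
  rintro _ ⟨r, hr, rfl⟩
  have h1 := hIC r hr
  have h2 : (x₀ - x) * P r ≤ |x₀ - x| := by
    calc _ ≤ |x₀ - x| * P r := mul_le_mul_of_nonneg_right (le_abs_self _) (hP r hr).1
      _ ≤ |x₀ - x| * 1 := mul_le_mul_of_nonneg_left (hP r hr).2 (abs_nonneg _)
      _ = _ := mul_one _
  simp only
  linarith

lemma indirectUtility_eq {x : ℝ} (hx : x ∈ Icc (0 : ℝ) 1)
    (hIC : ∀ r ∈ Icc (0 : ℝ) 1, T r - x * P r ≤ T x - x * P x) :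
    indirectUtility P T x = T x - x * P x := by
  refine IsGreatest.csSup_eq ⟨⟨x, hx, rfl⟩, ?_⟩
  rintro _ ⟨r, hr, rfl⟩
  exact hIC r hr

lemma lipschitzWith_indirectUtility (hP : ∀ r ∈ Icc (0 : ℝ) 1, P r ∈ Icc (0 : ℝ) 1)
    (hb : ∀ x, BddAbove ((fun r => T r - x * P r) '' Icc 0 1)) :
    LipschitzWith 1 (indirectUtility P T) := by
  refine LipschitzWith.of_le_add_mul 1 fun x y => ?_
  refine csSup_le ((nonempty_Icc.2 zero_le_one).image _) ?_
  rintro _ ⟨r, hr, rfl⟩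
  have h1 : T r - y * P r ≤ indirectUtility P T y := le_csSup (hb y) ⟨r, hr, rfl⟩
  have h2 : (y - x) * P r ≤ |y - x| := by
    calc _ ≤ |y - x| * P r := mul_le_mul_of_nonneg_right (le_abs_self _) (hP r hr).1
      _ ≤ |y - x| * 1 := mul_le_mul_of_nonneg_left (hP r hr).2 (abs_nonneg _)
      _ = _ := mul_one _
  rw [Real.dist_eq, abs_sub_comm, NNReal.coe_one, one_mul]
  simp only
  linarith

lemma deriv_indirectUtility (hb : ∀ x, BddAbove ((fun r => T r - x * P r) '' Icc 0 1)) {x : ℝ}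
    (hx : x ∈ Icc (0 : ℝ) 1) (hIC : ∀ r ∈ Icc (0 : ℝ) 1, T r - x * P r ≤ T x - x * P x)
    (hd : DifferentiableAt ℝ (indirectUtility P T) x) :
    deriv (indirectUtility P T) x = -P x := by
  have hmin : IsLocalMin (fun y => indirectUtility P T y + y * P x) x := by
    refine Eventually.of_forall fun y => ?_
    have h1 : T x - y * P x ≤ indirectUtility P T y := le_csSup (hb y) ⟨x, hx, rfl⟩
    simp only [indirectUtility_eq hx hIC]
    linarith
  have hder := hd.hasDerivAt.add ((hasDerivAt_id x).mul_const (P x))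
  have := hmin.hasDerivAt_eq_zero hder
  linarith

lemma antitoneOn_of_incentiveCompatible (hA : A ⊆ Icc 0 1)
    (hIC : ∀ x ∈ A, ∀ r ∈ Icc (0 : ℝ) 1, T r - x * P r ≤ T x - x * P x) : AntitoneOn P A := by
  intro x hx y hy hxy
  rcases hxy.eq_or_lt with rfl | hlt
  · exact le_rfl
  have h1 := hIC x hx y (hA hy)
  have h2 := hIC y hy x (hA hx)
  by_contra hcon
  push Not at hcon
  nlinarith

namespace Primitives

variable {f v : ℝ → ℝ} (h : Primitives f v)
include h

lemma absolutelyContinuousOnInterval_cdf : AbsolutelyContinuousOnInterval (cdf f) 0 1 :=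
  (h.intervalIntegrable_f (by simp) (by simp)).absolutelyContinuousOnInterval_intervalIntegral
    (by simp)

/-- The expected information rent of a seller, by integration by parts: the indirect utility is
Lipschitz with derivative `-P` wherever it is differentiable and truth-telling is optimal. -/
lemma integral_indirectUtility (hP : ∀ r ∈ Icc (0 : ℝ) 1, P r ∈ Icc (0 : ℝ) 1)
    (hA : A ⊆ Icc 0 1) (hAae : ∀ᵐ x ∂(volume.restrict (Icc (0 : ℝ) 1)), x ∈ A)
    (hIC : ∀ x ∈ A, ∀ r ∈ Icc (0 : ℝ) 1, T r - x * P r ≤ T x - x * P x) :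
    ∫ x in (0 : ℝ)..1, f x * (T x - x * P x)
      = indirectUtility P T 1 + ∫ x in (0 : ℝ)..1, cdf f x * P x := by
  obtain ⟨x₀, hx₀⟩ : A.Nonempty := by
    by_contra hcon
    rw [not_nonempty_iff_eq_empty] at hcon
    simp only [hcon, mem_empty_iff_false, eventually_false_iff_eq_bot, ae_eq_bot,
      Measure.restrict_eq_zero] at hAae
    simp at hAae
  have hb := fun x => bddAbove_payoffs hP (hIC x₀ hx₀) x
  have hL := lipschitzWith_indirectUtility hP hb
  have hAae' : ∀ᵐ x, x ∈ Icc (0 : ℝ) 1 → x ∈ A := (ae_restrict_iff' measurableSet_Icc).1 hAae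
  have hne1 : ∀ᵐ x : ℝ, x ≠ 1 := by simp [ae_iff]
  have hparts := AbsolutelyContinuousOnInterval.integral_mul_deriv_eq_deriv_mul
    (hL.lipschitzOnWith (s := uIcc 0 1)).absolutelyContinuousOnInterval
    h.absolutelyContinuousOnInterval_cdf
  rw [h.cdf_one, cdf_zero, mul_one, mul_zero, sub_zero] at hparts
  calc ∫ x in (0 : ℝ)..1, f x * (T x - x * P x)
      = ∫ x in (0 : ℝ)..1, indirectUtility P T x * deriv (cdf f) x := by
        refine intervalIntegral.integral_congr_ae ?_
        filter_upwards [hAae', hne1] with x hx hx1 hxI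
        rw [uIoc_of_le zero_le_one] at hxI
        have hxA := hx (Ioc_subset_Icc_self hxI)
        rw [indirectUtility_eq (hA hxA) (hIC x hxA),
          (h.hasDerivAt_cdf ⟨hxI.1, lt_of_le_of_ne hxI.2 hx1⟩).deriv, mul_comm]
    _ = _ := hparts
    _ = _ := by
        rw [sub_eq_add_neg, ← intervalIntegral.integral_neg]
        congr 1
        refine intervalIntegral.integral_congr_ae ?_
        filter_upwards [hAae', hL.ae_differentiableAt_real] with x hx hxd hxI
        rw [uIoc_of_le zero_le_one] at hxI
        have hxA := hx (Ioc_subset_Icc_self hxI)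
        rw [deriv_indirectUtility hb (hA hxA) (hIC x hxA) hxd]
        ring

/-- The buyer's expected surplus from one seller in terms of the virtual surplus. -/
lemma integral_surplus_eq (hPm : Measurable P) (hTi : Integrable T (qualityLaw f))
    (hP : ∀ r ∈ Icc (0 : ℝ) 1, P r ∈ Icc (0 : ℝ) 1)
    (hA : A ⊆ Icc 0 1) (hAae : ∀ᵐ x ∂(volume.restrict (Icc (0 : ℝ) 1)), x ∈ A)
    (hIC : ∀ x ∈ A, ∀ r ∈ Icc (0 : ℝ) 1, T r - x * P r ≤ T x - x * P x) :
    ∫ x, (v x * P x - T x) ∂(qualityLaw f)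
      = ∫ x, virtualSurplus f v x * P x ∂(qualityLaw f) - indirectUtility P T 1 := by
  have := h.isProbabilityMeasure_qualityLaw
  have hPabs : ∀ x ∈ Icc (0 : ℝ) 1, |P x| ≤ 1 := fun x hx => by
    rw [abs_of_nonneg (hP x hx).1]; exact (hP x hx).2
  have hbound : ∀ φ : ℝ → ℝ, ContinuousOn φ (Icc 0 1) →
      Integrable (fun x => φ x * P x) (qualityLaw f) := by
    intro φ hφ
    obtain ⟨C, hC⟩ := isCompact_Icc.exists_bound_of_continuousOn hφ
    refine h.integrable_of_bound (C := C) ((hφ.aemeasurable measurableSet_Icc).mul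
      hPm.aemeasurable) fun x hx => ?_
    have hx' := Ioo_subset_Icc_self hx
    rw [abs_mul]
    calc _ ≤ C * 1 := mul_le_mul (hC x hx') (hPabs x hx') (abs_nonneg _)
          ((norm_nonneg _).trans (hC x hx'))
      _ = C := mul_one C
  have hv := hbound v h.v_cont
  have hg := hbound _ h.continuousOn_virtualSurplus
  have hid := hbound id continuousOn_id
  have hrent : ∫ x, (T x - x * P x) ∂(qualityLaw f)
      = indirectUtility P T 1 + ∫ x in (0 : ℝ)..1, cdf f x * P x := by
    rw [h.integral_qualityLaw, integral_Icc_eq_integral_Ioc,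
      ← intervalIntegral.integral_of_le zero_le_one]
    exact h.integral_indirectUtility hP hA hAae hIC
  have hFP : ∫ x, (v x * P x - x * P x - virtualSurplus f v x * P x) ∂(qualityLaw f)
      = ∫ x in (0 : ℝ)..1, cdf f x * P x := by
    rw [h.integral_qualityLaw, integral_Icc_eq_integral_Ioc,
      intervalIntegral.integral_of_le zero_le_one]
    refine setIntegral_congr_fun measurableSet_Ioc fun x hx => ?_
    have := (h.pos x hx).ne'
    simp only [virtualSurplus]
    field_simp
    ring
  have e1 := integral_sub (hv.sub hid) hg
  have e2 := integral_sub hv hid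
  have e3 := integral_sub hTi hid
  have e4 := integral_sub hv hTi
  simp only [Pi.sub_apply, id] at e1 e2 e3 e4
  linarith

end Primitives

end Envelope

/-! ### Interim expectations -/

lemma measurable_update_pair {n : ℕ} (s : Fin n) :
    Measurable (fun z : ℝ × (Fin n → ℝ) => Function.update z.2 s z.1) := by
  refine measurable_pi_lambda _ fun k => ?_
  rcases eq_or_ne k s with rfl | hk
  · simpa using measurable_fst
  · simp only [Function.update_of_ne hk]
    fun_prop

/-- Resampling one coordinate of an i.i.d. profile preserves its law. -/
lemma measurePreserving_update {n : ℕ} (μ : Measure ℝ) [IsProbabilityMeasure μ] (s : Fin n) :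
    MeasurePreserving (fun z : ℝ × (Fin n → ℝ) => Function.update z.2 s z.1)
      (μ.prod (Measure.pi fun _ => μ)) (Measure.pi fun _ => μ) := by
  have hm := measurable_update_pair (n := n) s
  refine ⟨hm, (Measure.pi_eq fun B hB => ?_).symm⟩
  rw [Measure.map_apply hm (MeasurableSet.univ_pi hB)]
  have : (fun z : ℝ × (Fin n → ℝ) => Function.update z.2 s z.1) ⁻¹' univ.pi B
      = B s ×ˢ univ.pi (Function.update B s univ) := by
    ext z
    simp only [mem_preimage, mem_univ_pi, mem_prod]
    constructor
    · intro hz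
      refine ⟨by simpa using hz s, fun k => ?_⟩
      rcases eq_or_ne k s with rfl | hk
      · simp
      · simpa [hk] using hz k
    · rintro ⟨h1, h2⟩ k
      rcases eq_or_ne k s with rfl | hk
      · simpa using h1
      · simpa [hk] using h2 k
  rw [this, Measure.prod_prod, Measure.pi_pi, ← Finset.mul_prod_erase _ _ (Finset.mem_univ s),
    ← Finset.mul_prod_erase (Finset.univ) (fun k => μ (B k)) (Finset.mem_univ s)]
  simp only [Function.update_self, measure_univ, one_mul]
  congr 1
  refine Finset.prod_congr rfl fun k hk => ?_
  rw [Function.update_of_ne (Finset.ne_of_mem_erase hk)]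

/-! ### The buyer's payoff in terms of virtual surplus -/

namespace Primitives

variable {f v : ℝ → ℝ} (h : Primitives f v) {n : ℕ}
include h

lemma isProbabilityMeasure_profileLaw : IsProbabilityMeasure (profileLaw f n) := by
  have := h.isProbabilityMeasure_qualityLaw
  unfold profileLaw
  infer_instance

lemma ae_profile {p : ℝ → Prop} (hp : ∀ᵐ x ∂(qualityLaw f), p x) :
    ∀ᵐ q ∂(profileLaw f n), ∀ k, p (q k) := by
  have := h.isProbabilityMeasure_qualityLaw
  rw [eventually_countable_forall]
  exact fun k => (measurePreserving_eval (fun _ : Fin n => qualityLaw f)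
    k).quasiMeasurePreserving.ae hp

lemma ae_update_mem (s : Fin n) {r : ℝ} (hr : r ∈ Icc (0 : ℝ) 1) :
    ∀ᵐ q ∂(profileLaw f n), ∀ k, Function.update q s r k ∈ Icc (0 : ℝ) 1 := by
  filter_upwards [h.ae_profile (ae_mem_Icc (f := f))] with q hq k
  rcases eq_or_ne k s with rfl | hk
  · simpa using hr
  · simpa [hk] using hq k

lemma integrable_comp_update {Φ : (Fin n → ℝ) → ℝ} (hΦ : Integrable Φ (profileLaw f n))
    (s : Fin n) :
    Integrable (fun z : ℝ × (Fin n → ℝ) => Φ (Function.update z.2 s z.1))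
      ((qualityLaw f).prod (profileLaw f n)) := by
  have := h.isProbabilityMeasure_qualityLaw
  exact (measurePreserving_update (qualityLaw f) s).integrable_comp_of_integrable hΦ

lemma integrable_interim_integral {Φ : (Fin n → ℝ) → ℝ} (hΦ : Integrable Φ (profileLaw f n))
    (s : Fin n) :
    Integrable (fun r => ∫ q, Φ (Function.update q s r) ∂(profileLaw f n)) (qualityLaw f) := by
  have := h.isProbabilityMeasure_qualityLaw
  have := h.isProbabilityMeasure_profileLaw (n := n)
  exact (h.integrable_comp_update hΦ s).integral_prod_left

lemma integral_interim {Φ : (Fin n → ℝ) → ℝ} (hΦ : Integrable Φ (profileLaw f n)) (s : Fin n) :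
    ∫ r, (∫ q, Φ (Function.update q s r) ∂(profileLaw f n)) ∂(qualityLaw f)
      = ∫ q, Φ q ∂(profileLaw f n) := by
  have := h.isProbabilityMeasure_qualityLaw
  have := h.isProbabilityMeasure_profileLaw (n := n)
  have hmp := measurePreserving_update (qualityLaw f) s
  rw [← integral_prod _ (h.integrable_comp_update hΦ s)]
  change _ = ∫ q, Φ q ∂(Measure.pi fun _ => qualityLaw f)
  rw [← hmp.map_eq, integral_map hmp.measurable.aemeasurable]
  · rfl
  · rw [hmp.map_eq]
    exact hΦ.aestronglyMeasurable

variable {m : DirectMechanism n} (hm : m.Feasible f)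
include hm

lemma ae_p_mem (s : Fin n) : ∀ᵐ q ∂(profileLaw f n), m.p s q ∈ Icc (0 : ℝ) 1 := by
  filter_upwards [h.ae_profile (ae_mem_Icc (f := f))] with q hq
  exact hm.p_mem s q hq

lemma ae_p_update_mem (s : Fin n) {r : ℝ} (hr : r ∈ Icc (0 : ℝ) 1) :
    ∀ᵐ q ∂(profileLaw f n), m.p s (Function.update q s r) ∈ Icc (0 : ℝ) 1 := by
  filter_upwards [h.ae_update_mem s hr] with q hq
  exact hm.p_mem s _ hq

omit h in
lemma measurable_p_update (s : Fin n) (r : ℝ) :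
    Measurable fun q => m.p s (Function.update q s r) :=
  (hm.measurable_p s).comp ((measurable_update_pair s).comp (measurable_const.prodMk measurable_id))

lemma integrable_p_update (s : Fin n) {r : ℝ} (hr : r ∈ Icc (0 : ℝ) 1) :
    Integrable (fun q => m.p s (Function.update q s r)) (profileLaw f n) := by
  have := h.isProbabilityMeasure_profileLaw (n := n)
  refine Integrable.of_bound (measurable_p_update hm s r).aestronglyMeasurable 1 ?_
  filter_upwards [h.ae_p_update_mem hm s hr] with q hq
  rw [Real.norm_of_nonneg hq.1]
  exact hq.2

lemma interimP_mem (s : Fin n) {r : ℝ} (hr : r ∈ Icc (0 : ℝ) 1) :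
    m.interimP f s r ∈ Icc (0 : ℝ) 1 := by
  have := h.isProbabilityMeasure_profileLaw (n := n)
  have hae := h.ae_p_update_mem hm s hr
  refine ⟨integral_nonneg_of_ae (hae.mono fun q hq => hq.1), ?_⟩
  calc m.interimP f s r ≤ ∫ _, (1 : ℝ) ∂(profileLaw f n) :=
        integral_mono_ae (h.integrable_p_update hm s hr) (integrable_const _)
          (hae.mono fun q hq => hq.2)
    _ = 1 := by simp

lemma measurable_interimP (s : Fin n) : Measurable (m.interimP f s) := by
  have := h.isProbabilityMeasure_profileLaw (n := n)
  exact (((hm.measurable_p s).comp (measurable_update_pair s)).stronglyMeasurable.integral_prod_right'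
    (ν := profileLaw f n)).measurable

lemma integrable_interimT (s : Fin n) : Integrable (m.interimT f s) (qualityLaw f) :=
  h.integrable_interim_integral (hm.integrable_t s) s

lemma integrable_weight_mul_p {φ : ℝ → ℝ} (hφ : Integrable φ (qualityLaw f)) (s : Fin n) :
    Integrable (fun q => φ (q s) * m.p s q) (profileLaw f n) := by
  have := h.isProbabilityMeasure_qualityLaw
  have hφs : Integrable (fun q : Fin n → ℝ => φ (q s)) (profileLaw f n) :=
    (measurePreserving_eval (fun _ : Fin n => qualityLaw f) s).integrable_comp_of_integrable hφ
  refine hφs.mul_bdd (c := 1) (hm.measurable_p s).aestronglyMeasurable ?_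
  filter_upwards [h.ae_p_mem hm s] with q hq
  rw [Real.norm_of_nonneg hq.1]
  exact hq.2

lemma integral_weight_mul_interimP {φ : ℝ → ℝ} (hφ : Integrable φ (qualityLaw f)) (s : Fin n) :
    ∫ x, φ x * m.interimP f s x ∂(qualityLaw f) = ∫ q, φ (q s) * m.p s q ∂(profileLaw f n) := by
  rw [← h.integral_interim (h.integrable_weight_mul_p hm hφ s) s]
  refine integral_congr_ae (Eventually.of_forall fun r => ?_)
  simp only [Function.update_self, DirectMechanism.interimP, integral_const_mul]

omit hm in
lemma integrable_v : Integrable v (qualityLaw f) := by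
  obtain ⟨C, hC⟩ := isCompact_Icc.exists_bound_of_continuousOn h.v_cont
  exact h.integrable_of_bound (h.v_cont.aemeasurable measurableSet_Icc)
    fun x hx => hC x (Ioo_subset_Icc_self hx)

/-- The revenue formula: the buyer's payoff is the expected virtual surplus of the winner, less the
rents of sellers of quality `1`. -/
lemma buyerPayoff_eq (hIC : m.IncentiveCompatible f) :
    m.buyerPayoff f v = ∑ s, (∫ x, virtualSurplus f v x * m.interimP f s x ∂(qualityLaw f)
      - indirectUtility (m.interimP f s) (m.interimT f s) 1) := by
  unfold DirectMechanism.buyerPayoff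
  refine Finset.sum_congr rfl fun s _ => ?_
  have hICs := hIC s
  have hint : Integrable (fun q => v (q s) * m.p s q - m.t s q) (profileLaw f n) :=
    (h.integrable_weight_mul_p hm h.integrable_v s).sub (hm.integrable_t s)
  rw [← h.integral_interim hint s, ← h.integral_surplus_eq (h.measurable_interimP hm s)
    (h.integrable_interimT hm s) (fun r hr => h.interimP_mem hm s hr)
    (A := {x | x ∈ Icc (0 : ℝ) 1 ∧ ∀ r ∈ Icc (0 : ℝ) 1,
      m.sellerPayoff f s r x ≤ m.sellerPayoff f s x x}) (fun x hx => hx.1)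
    ((ae_restrict_mem measurableSet_Icc).and hICs) (fun x hx => hx.2)]
  refine integral_congr_ae ?_
  filter_upwards [ae_mem_Icc (f := f)] with r hr
  rw [integral_sub]
  · simp only [Function.update_self, DirectMechanism.interimP, integral_const_mul,
      DirectMechanism.interimT]
  · simp only [Function.update_self]
    exact (h.integrable_p_update hm s hr).const_mul _
  · exact hm.integrable_interim s r hr

lemma integral_diff_mul (s : Fin n) :
    ∫ x, (virtualSurplus f v x - ironedSurplus f v (cdf f x)) * m.interimP f s x ∂(qualityLaw f)
      = ∫ x, virtualSurplus f v x * m.interimP f s x ∂(qualityLaw f)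
        - ∫ q, ironedSurplus f v (cdf f (q s)) * m.p s q ∂(profileLaw f n) := by
  have := h.isProbabilityMeasure_qualityLaw
  have hb : ∀ φ : ℝ → ℝ, Integrable φ (qualityLaw f) →
      Integrable (fun x => φ x * m.interimP f s x) (qualityLaw f) := by
    intro φ hφ
    refine hφ.mul_bdd (c := 1) (h.measurable_interimP hm s).aestronglyMeasurable ?_
    filter_upwards [ae_mem_Icc (f := f)] with x hx
    rw [Real.norm_of_nonneg (h.interimP_mem hm s hx).1]
    exact (h.interimP_mem hm s hx).2
  rw [← h.integral_weight_mul_interimP hm h.integrable_ironedSurplus s,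
    ← integral_sub (hb _ h.integrable_virtualSurplus) (hb _ h.integrable_ironedSurplus)]
  simp only [sub_mul]

/-- No incentive-compatible mechanism that gives sellers of quality `1` a non-negative payoff yields
more than the expected ironed surplus of its winner, since interim winning probabilities are
decreasing. -/
lemma buyerPayoff_le (hIC : m.IncentiveCompatible f) (hIR : ∀ s, 0 ≤ m.sellerPayoff f s 1 1) :
    m.buyerPayoff f v
      ≤ ∑ s, ∫ q, ironedSurplus f v (cdf f (q s)) * m.p s q ∂(profileLaw f n) := by
  rw [h.buyerPayoff_eq hm hIC]
  refine Finset.sum_le_sum fun s _ => ?_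
  set A := {x | x ∈ Icc (0 : ℝ) 1 ∧ ∀ r ∈ Icc (0 : ℝ) 1,
      m.sellerPayoff f s r x ≤ m.sellerPayoff f s x x}
  have hAae : ∀ᵐ x ∂(volume.restrict (Icc (0 : ℝ) 1)), x ∈ A :=
    (ae_restrict_mem measurableSet_Icc).and (hIC s)
  have hA : A ⊆ Icc 0 1 := fun x hx => hx.1
  have hanti : AntitoneOn (m.interimP f s) A :=
    antitoneOn_of_incentiveCompatible (T := m.interimT f s) hA fun x hx => hx.2
  have h1 := h.integral_surplus_diff_mul_nonpos (v := v) (h.measurable_interimP hm s)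
    (fun x hx => h.interimP_mem hm s hx) hA (qualityLaw_absolutelyContinuous.ae_le hAae) hanti
  rw [h.integral_diff_mul hm s] at h1
  have h2 : 0 ≤ indirectUtility (m.interimP f s) (m.interimT f s) 1 := by
    have := h.isProbabilityMeasure_qualityLaw
    have hAae' : ∀ᵐ x ∂(qualityLaw f), x ∈ A := qualityLaw_absolutelyContinuous.ae_le hAae
    obtain ⟨x₀, hx₀⟩ := hAae'.exists
    exact (hIR s).trans (le_csSup (bddAbove_payoffs (fun r hr => h.interimP_mem hm s hr) hx₀.2 1)
      ⟨1, by simp, rfl⟩)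
  linarith

/-- The bound is attained if sellers of quality `1` have no rent and the jumps of the interim
winning probabilities are located where the cumulative surplus coincides with its hull. -/
lemma buyerPayoff_eq_of_levels
    (hIC : ∀ s, ∀ x ∈ Icc (0 : ℝ) 1, ∀ r ∈ Icc (0 : ℝ) 1,
      m.sellerPayoff f s r x ≤ m.sellerPayoff f s x x)
    (hIR : ∀ s, m.sellerPayoff f s 1 1 = 0)
    (hlevel : ∀ s, ∀ t ∈ Ioo (0 : ℝ) 1, ∀ c ∈ Icc (0 : ℝ) 1,
      IsLUB ({x | t < m.interimP f s x} ∩ Icc 0 1) c →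
        ironedCumSurplus f v (cdf f c) = cumSurplus f v (cdf f c)) :
    m.buyerPayoff f v
      = ∑ s, ∫ q, ironedSurplus f v (cdf f (q s)) * m.p s q ∂(profileLaw f n) := by
  have hIC' : m.IncentiveCompatible f := fun s =>
    ae_restrict_of_forall_mem measurableSet_Icc (hIC s)
  rw [h.buyerPayoff_eq hm hIC']
  refine Finset.sum_congr rfl fun s _ => ?_
  have h1 := h.integral_surplus_diff_mul_eq_zero (v := v) (h.measurable_interimP hm s)
    (fun x hx => h.interimP_mem hm s hx)
    (antitoneOn_of_incentiveCompatible (T := m.interimT f s) subset_rfl (hIC s)) (hlevel s)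
  rw [h.integral_diff_mul hm s] at h1
  have h2 : indirectUtility (m.interimP f s) (m.interimT f s) 1 = 0 :=
    (indirectUtility_eq (by simp) (hIC s 1 (by simp))).trans (hIR s)
  linarith

end Primitives

/-! ### The bidding strategy of a bid-restricted auction -/

namespace BRA

variable {B : BRA} {n : ℕ}

namespace Valid

variable (hB : B.Valid)
include hB

lemma upper_lt_lower {i j : ℕ} (hi : 1 ≤ i) (hij : i < j) (hj : j ≤ B.M) :
    B.upper i < B.lower j := by
  induction j, hij using Nat.le_induction with
  | base => exact hB.gap i hi (by omega)
  | succ k hk ih =>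
    exact (ih (by omega)).trans ((hB.lower_le_upper k (by omega) (by omega)).trans_lt
      (hB.gap k (by omega) (by omega)))

lemma upper_mono {i j : ℕ} (hi : 1 ≤ i) (hij : i ≤ j) (hj : j ≤ B.M) :
    B.upper i ≤ B.upper j := by
  rcases hij.eq_or_lt with rfl | hlt
  · exact le_rfl
  · exact (hB.upper_lt_lower hi hlt hj).le.trans (hB.lower_le_upper j (by omega) hj)

lemma lower_strictMono {i j : ℕ} (hi : 1 ≤ i) (hij : i < j) (hj : j ≤ B.M) :
    B.lower i < B.lower j :=
  (hB.lower_le_upper i hi (by omega)).trans_lt (hB.upper_lt_lower hi hij hj)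

lemma lower_inj {i j : ℕ} (hi : 1 ≤ i) (hi' : i ≤ B.M) (hj : 1 ≤ j) (hj' : j ≤ B.M)
    (h : B.lower i = B.lower j) : i = j := by
  rcases lt_trichotomy i j with hlt | heq | hlt
  · exact absurd h (hB.lower_strictMono hi hlt hj').ne
  · exact heq
  · exact absurd h (hB.lower_strictMono hj hlt hi').ne'

lemma lower_nonneg {i : ℕ} (hi : 1 ≤ i) (hi' : i ≤ B.M) : 0 ≤ B.lower i := by
  rcases hi.eq_or_lt with rfl | hlt
  · exact hB.nonneg
  · exact hB.nonneg.trans (hB.lower_strictMono le_rfl hlt hi').le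

lemma upper_le_one {i : ℕ} (hi : 1 ≤ i) (hi' : i ≤ B.M) : B.upper i ≤ 1 :=
  (hB.upper_mono hi hi' le_rfl).trans hB.le_one

lemma upper_nonneg {i : ℕ} (hi : 1 ≤ i) (hi' : i ≤ B.M) : 0 ≤ B.upper i :=
  (hB.lower_nonneg hi hi').trans (hB.lower_le_upper i hi hi')

/-- The bid of a participating seller: `max x (lower i)` in the first interval with
`x < upper i`. -/
lemma exists_bid_eq {x : ℝ} (hx : x < B.upper B.M) :
    ∃ i, 1 ≤ i ∧ i ≤ B.M ∧ x < B.upper i ∧ (∀ j, 1 ≤ j → j < i → B.upper j ≤ x) ∧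
      B.bid x = ((max x (B.lower i) : ℝ) : WithTop ℝ) := by
  have hne : {i : ℕ | 1 ≤ i ∧ i ≤ B.M ∧ x < B.upper i}.Nonempty := ⟨B.M, hB.one_le, le_rfl, hx⟩
  obtain ⟨h1, h2, h3⟩ := Nat.sInf_mem hne
  refine ⟨sInf {i : ℕ | 1 ≤ i ∧ i ≤ B.M ∧ x < B.upper i}, h1, h2, h3, fun j hj hlt => ?_, ?_⟩
  · by_contra hcon
    exact Nat.notMem_of_lt_sInf hlt ⟨hj, by omega, not_le.1 hcon⟩
  · simp only [bid, if_pos hx]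
    split_ifs with hle
    · rw [max_eq_left hle]
    · rw [max_eq_right (not_le.1 hle).le]

omit hB in
lemma bid_eq_top {x : ℝ} (hx : B.upper B.M ≤ x) : B.bid x = ⊤ := by
  simp [bid, not_lt.2 hx]

lemma bid_eq_top_iff {x : ℝ} : B.bid x = ⊤ ↔ B.upper B.M ≤ x := by
  refine ⟨fun h => ?_, bid_eq_top⟩
  by_contra hlt
  obtain ⟨i, -, -, -, -, heq⟩ := hB.exists_bid_eq (not_le.1 hlt)
  rw [heq] at h
  exact WithTop.coe_ne_top h

lemma le_bid (x : ℝ) : (x : WithTop ℝ) ≤ B.bid x := by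
  rcases lt_or_ge x (B.upper B.M) with hx | hx
  · obtain ⟨i, -, -, -, -, heq⟩ := hB.exists_bid_eq hx
    rw [heq]
    exact WithTop.coe_le_coe.2 (le_max_left _ _)
  · rw [bid_eq_top hx]
    exact le_top

lemma bid_le {x : ℝ} {j : ℕ} (hj : 1 ≤ j) (hj' : j ≤ B.M) (hx : x < B.upper j) :
    B.bid x ≤ ((max x (B.lower j) : ℝ) : WithTop ℝ) := by
  obtain ⟨i, h1, h2, h3, h4, heq⟩ := hB.exists_bid_eq (hx.trans_le (hB.upper_mono hj hj' le_rfl))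
  rw [heq]
  refine WithTop.coe_le_coe.2 (max_le_max le_rfl ?_)
  by_contra hcon
  push Not at hcon
  have hij : j < i := by
    by_contra hle
    rcases (not_lt.1 hle).eq_or_lt with rfl | hlt
    · exact lt_irrefl _ hcon
    · exact lt_asymm hcon (hB.lower_strictMono h1 hlt hj')
  exact (h4 j hj hij).not_gt hx

lemma bid_mono : Monotone B.bid := by
  intro x y hxy
  rcases lt_or_ge y (B.upper B.M) with hy | hy
  · obtain ⟨i, h1, h2, h3, -, heq⟩ := hB.exists_bid_eq hy
    rw [heq]
    exact (hB.bid_le h1 h2 (hxy.trans_lt h3)).trans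
      (WithTop.coe_le_coe.2 (max_le_max hxy le_rfl))
  · rw [bid_eq_top hy]
    exact le_top

lemma permissible_bid (x : ℝ) : B.Permissible (B.bid x) := by
  rcases lt_or_ge x (B.upper B.M) with hx | hx
  · obtain ⟨i, h1, h2, h3, -, heq⟩ := hB.exists_bid_eq hx
    refine Or.inr ⟨i, h1, h2, ?_, ?_⟩ <;> rw [heq, WithTop.coe_le_coe]
    · exact le_max_right _ _
    · exact max_le h3.le (hB.lower_le_upper i h1 h2)
  · exact Or.inl (bid_eq_top hx)

end Valid

/-! ### Winning probabilities and payments -/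

/-- The lowest of the bids of the sellers other than `s`. -/
def rivalBid (b : Fin n → WithTop ℝ) (s : Fin n) : WithTop ℝ := (Finset.univ.erase s).inf b

/-- The number of sellers other than `s` who make the lowest of these bids. -/
def rivalCount (b : Fin n → WithTop ℝ) (s : Fin n) : ℕ :=
  ((Finset.univ.erase s).filter fun k => b k = rivalBid b s).card

variable {b : Fin n → WithTop ℝ} {s : Fin n} {β : WithTop ℝ}

lemma rivalBid_le {k : Fin n} (hk : k ≠ s) : rivalBid b s ≤ b k :=
  Finset.inf_le (Finset.mem_erase.2 ⟨hk, Finset.mem_univ k⟩)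

lemma exists_rivalBid_eq (h : rivalBid b s ≠ ⊤) : ∃ k, k ≠ s ∧ b k = rivalBid b s := by
  have hne : (Finset.univ.erase s).Nonempty := by
    by_contra hcon
    rw [Finset.not_nonempty_iff_eq_empty] at hcon
    exact h (by simp [rivalBid, hcon])
  obtain ⟨k, hk, heq⟩ := Finset.exists_mem_eq_inf _ hne b
  exact ⟨k, Finset.ne_of_mem_erase hk, heq.symm⟩

lemma rivalBid_update : rivalBid (Function.update b s β) s = rivalBid b s :=
  Finset.inf_congr rfl fun _ hk => Function.update_of_ne (Finset.ne_of_mem_erase hk) _ _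

lemma rivalCount_pos (h : rivalBid b s ≠ ⊤) : 1 ≤ rivalCount b s := by
  obtain ⟨k, hk, heq⟩ := exists_rivalBid_eq h
  exact Finset.card_pos.2 ⟨k, by simp [hk, heq]⟩

lemma winProb_of_rivalBid_lt (h : rivalBid b s < b s) : winProb b s = 0 := by
  obtain ⟨k, -, heq⟩ := exists_rivalBid_eq (ne_top_of_lt h)
  refine if_neg fun hcon => ?_
  exact (heq ▸ hcon.2 k).not_gt h

lemma winProb_of_top (h : b s = ⊤) : winProb b s = 0 := if_neg fun hcon => hcon.1 h

lemma winProb_of_lt_rivalBid (h : b s < rivalBid b s) : winProb b s = 1 := by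
  have hk : ∀ k, k ≠ s → b s < b k := fun k hk => h.trans_le (rivalBid_le hk)
  have hcard : (Finset.univ.filter fun k => b k = b s) = {s} := by
    ext k
    simp only [Finset.mem_filter, Finset.mem_univ, true_and, Finset.mem_singleton]
    exact ⟨fun he => by_contra fun hne => (hk k hne).ne' he, fun he => he ▸ rfl⟩
  rw [winProb, if_pos, hcard]
  · simp
  · refine ⟨ne_top_of_lt h, fun k => ?_⟩
    rcases eq_or_ne k s with rfl | hne
    · exact le_rfl
    · exact (hk k hne).le

lemma winProb_of_eq_rivalBid (h : b s = rivalBid b s) (htop : b s ≠ ⊤) :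
    winProb b s = 1 / ((rivalCount b s : ℝ) + 1) := by
  have hcard : (Finset.univ.filter fun k => b k = b s)
      = insert s ((Finset.univ.erase s).filter fun k => b k = rivalBid b s) := by
    ext k
    simp only [Finset.mem_filter, Finset.mem_univ, true_and, Finset.mem_insert, Finset.mem_erase,
      and_true, h]
    rcases eq_or_ne k s with rfl | hne
    · simp [h]
    · simp [hne]
  rw [winProb, if_pos, hcard, Finset.card_insert_of_notMem (by simp), rivalCount]
  · push_cast
    rfl
  · refine ⟨htop, fun k => ?_⟩
    rcases eq_or_ne k s with rfl | hne
    · exact le_rfl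
    · exact h ▸ rivalBid_le hne

lemma secondLowest_eq : B.secondLowest b s = (rivalBid b s).untopD (B.upper B.M) := rfl

lemma payment_of_not_reduces (h : ∀ j, ¬ B.Reduces b s j) :
    B.payment b s = (rivalBid b s).untopD (B.upper B.M) := by
  rw [payment, if_neg (by simpa using h), secondLowest_eq]

lemma Valid.payment_of_reduces (hB : B.Valid) {j : ℕ} (h : B.Reduces b s j) :
    B.payment b s = (B.lower j + ((Finset.univ.filter fun l => b l = (B.lower j : WithTop ℝ)).card
      : ℝ) * B.upper (j - 1)) /
      (((Finset.univ.filter fun l => b l = (B.lower j : WithTop ℝ)).card : ℝ) + 1) := by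
  have hex : ∃ j, B.Reduces b s j := ⟨j, h⟩
  have hj : sInf {j | B.Reduces b s j} = j := by
    obtain ⟨i', hi', -, hlt', hM', heq'⟩ := Nat.sInf_mem (s := {j | B.Reduces b s j}) ⟨j, h⟩
    obtain ⟨i, hi, -, hlt, hM, heq⟩ := h
    exact hB.lower_inj (by omega) hM' (by omega) hM (heq'.symm.trans heq)
  rw [payment, if_pos hex, hj]

/-- A winner who has to share the winning bid is paid this bid. -/
lemma payment_of_eq_rivalBid (h : b s = rivalBid b s) :
    B.payment b s = (rivalBid b s).untopD (B.upper B.M) := by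
  refine payment_of_not_reduces ?_
  rintro j ⟨i, hi, halone, -⟩
  have htop : rivalBid b s ≠ ⊤ := by
    rw [← h]
    exact ne_top_of_le_ne_top WithTop.coe_ne_top hi.2.2.2
  obtain ⟨k, hk, heq⟩ := exists_rivalBid_eq htop
  exact halone k hk (by rwa [heq, ← h])

/-- A winner without competitors is paid the highest permissible bid. If that bid is the lower
endpoint of the last interval, the reduction rule applies, but with no bids at that endpoint. -/
lemma Valid.payment_of_rivalBid_eq_top (hB : B.Valid) (h : rivalBid b s = ⊤) :
    B.payment b s = B.upper B.M := by
  by_cases hex : ∃ j, B.Reduces b s j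
  · obtain ⟨j, hj⟩ := hex
    rw [hB.payment_of_reduces hj]
    obtain ⟨i, hi, -, hlt, hM, heq⟩ := hj
    have hcard : (Finset.univ.filter fun l => b l = (B.lower j : WithTop ℝ)) = ∅ := by
      refine Finset.filter_eq_empty_iff.2 fun l _ hl => ?_
      rcases eq_or_ne l s with rfl | hne
      · have h1 := hi.2.2.2
        rw [hl, WithTop.coe_le_coe] at h1
        exact h1.not_gt (hB.upper_lt_lower hi.1 hlt hM)
      · have h1 := rivalBid_le (b := b) hne
        rw [h, hl] at h1
        exact WithTop.coe_ne_top (top_le_iff.1 h1)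
    rw [secondLowest_eq, h, WithTop.untopD_top] at heq
    rw [hcard, heq]
    simp
  · rw [payment_of_not_reduces (not_exists.1 hex), h, WithTop.untopD_top]

/-- The payment reduction rule: the winner bids below the lower endpoint of the interval `j`, which
is the lowest bid of her competitors. -/
lemma Valid.payment_of_lt_lower (hB : B.Valid) {j : ℕ} (hj : 1 ≤ j) (hjM : j ≤ B.M)
    (hr : rivalBid b s = (B.lower j : WithTop ℝ)) (hlt : b s < (B.lower j : WithTop ℝ))
    (hperm : B.Permissible (b s)) :
    2 ≤ j ∧ B.payment b s =
      (B.lower j + (rivalCount b s : ℝ) * B.upper (j - 1)) / ((rivalCount b s : ℝ) + 1) := by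
  obtain ⟨i, hi1, hiM, hilo, hihi⟩ := hperm.resolve_left (ne_top_of_lt hlt)
  have hij : i < j := by
    by_contra hcon
    push Not at hcon
    have h1 : B.lower j ≤ B.lower i := by
      rcases hcon.eq_or_lt with rfl | h
      · exact le_rfl
      · exact (hB.lower_strictMono hj h hiM).le
    exact ((WithTop.coe_le_coe.2 h1).trans hilo).not_gt hlt
  have hred : B.Reduces b s j := by
    refine ⟨i, ⟨hi1, hiM, hilo, hihi⟩, fun k hk hin => ?_, hij, hjM, ?_⟩
    · have h1 := rivalBid_le (b := b) hk
      rw [hr] at h1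
      have h2 := WithTop.coe_le_coe.1 (h1.trans hin.2.2.2)
      exact h2.not_gt (hB.upper_lt_lower hi1 hij hjM)
    · rw [secondLowest_eq, hr, WithTop.untopD_coe]
  have hcard : (Finset.univ.filter fun l => b l = (B.lower j : WithTop ℝ))
      = (Finset.univ.erase s).filter fun k => b k = rivalBid b s := by
    ext k
    simp only [Finset.mem_filter, Finset.mem_univ, true_and, Finset.mem_erase, and_true, hr]
    refine ⟨fun hk => ⟨?_, hk⟩, fun hk => hk.2⟩
    rintro rfl
    exact hlt.ne hk
  refine ⟨by omega, ?_⟩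
  rw [hB.payment_of_reduces hred, hcard, rivalCount]

lemma payment_of_forall_ne (hr : ∀ j, 1 ≤ j → j ≤ B.M → rivalBid b s ≠ (B.lower j : WithTop ℝ))
    (htop : rivalBid b s ≠ ⊤) : B.payment b s = (rivalBid b s).untopD (B.upper B.M) := by
  refine payment_of_not_reduces ?_
  rintro j ⟨i, hi, -, hlt, hM, heq⟩
  refine hr j (by omega) hM ?_
  obtain ⟨y, hy⟩ := WithTop.ne_top_iff_exists.1 htop
  rw [← heq, secondLowest_eq, ← hy, WithTop.untopD_coe]

/-! ### Dominance -/

lemma payoff_eq_zero_of_winProb {x : ℝ} (h : winProb b s = 0) : B.payoff b s x = 0 := by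
  rw [payoff, h, zero_mul]

/-- Against any permissible rival bids, the strategy is at least as good as any other bid. If the
lowest rival bid is a lower endpoint `lower j` made by `k` rivals, the reduced payment makes sellers
of quality `upper (j - 1)` indifferent between beating and matching this bid. -/
lemma Valid.payoff_le (hB : B.Valid) (hperm : ∀ k, B.Permissible (b k)) (x : ℝ) :
    B.payoff b s x ≤ B.payoff (Function.update b s (B.bid x)) s x := by
  set b' := Function.update b s (B.bid x) with hb'
  have hbs' : b' s = B.bid x := by simp [hb']
  have hr' : rivalBid b' s = rivalBid b s := rivalBid_update
  have hperm' : B.Permissible (b' s) := hbs' ▸ hB.permissible_bid x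
  have hcount : rivalCount b' s = rivalCount b s := by
    unfold rivalCount
    rw [hr']
    congr 1
    refine Finset.filter_congr fun k hk => ?_
    rw [hb', Function.update_of_ne (Finset.ne_of_mem_erase hk)]
  rcases eq_or_ne (rivalBid b s) ⊤ with htop | htop
  · -- no competitors
    have key : ∀ c : Fin n → WithTop ℝ, rivalBid c s = ⊤ → c s ≠ ⊤ →
        B.payoff c s x = B.upper B.M - x := by
      intro c hc hcs
      rw [payoff, winProb_of_lt_rivalBid (by rw [hc]; exact lt_top_iff_ne_top.2 hcs),
        hB.payment_of_rivalBid_eq_top hc, one_mul]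
    have hval : B.payoff b s x ≤ max (B.upper B.M - x) 0 := by
      by_cases hbs : b s = ⊤
      · rw [payoff_eq_zero_of_winProb (winProb_of_top hbs)]
        exact le_max_right _ _
      · rw [key b htop hbs]
        exact le_max_left _ _
    refine hval.trans ?_
    rcases lt_or_ge x (B.upper B.M) with hx | hx
    · rw [key b' (hr'.trans htop) (by rw [hbs']; simpa [hB.bid_eq_top_iff] using hx)]
      exact max_le le_rfl (by linarith)
    · rw [payoff_eq_zero_of_winProb (winProb_of_top (hbs'.trans (Valid.bid_eq_top hx)))]
      exact max_le (by linarith) le_rfl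
  obtain ⟨k₀, hk₀, heq₀⟩ := exists_rivalBid_eq htop
  obtain ⟨j, hj1, hjM, hjlo, hjhi⟩ := (hperm k₀).resolve_left (heq₀ ▸ htop)
  rw [heq₀] at hjlo hjhi
  obtain ⟨y, hy⟩ := WithTop.ne_top_iff_exists.1 htop
  rw [← hy, WithTop.coe_le_coe] at hjlo hjhi
  have hκ : (1 : ℝ) ≤ rivalCount b s := by exact_mod_cast rivalCount_pos htop
  set κ : ℝ := (rivalCount b s : ℝ) with hκdef
  have hκ1 : (0 : ℝ) < κ + 1 := by linarith
  have hgt : ∀ c : Fin n → WithTop ℝ, rivalBid c s = rivalBid b s → (y : WithTop ℝ) < c s →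
      B.payoff c s x = 0 := fun c hc hlt =>
    payoff_eq_zero_of_winProb (winProb_of_rivalBid_lt (by rwa [hc, ← hy]))
  have heq : ∀ c : Fin n → WithTop ℝ, rivalBid c s = rivalBid b s →
      rivalCount c s = rivalCount b s → c s = (y : WithTop ℝ) →
      B.payoff c s x = (y - x) / (κ + 1) := by
    intro c hc hcc hcs
    have h1 : c s = rivalBid c s := by rw [hcs, hc, hy]
    rw [payoff, winProb_of_eq_rivalBid h1 (by rw [hcs]; exact WithTop.coe_ne_top),
      payment_of_eq_rivalBid h1, hc, ← hy, WithTop.untopD_coe, hcc]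
    ring
  have hxbid := hB.le_bid x
  -- a seller whose quality is at least the lowest rival bid loses or breaks even
  have hhigh : y ≤ x → B.payoff b' s x = 0 := by
    intro hyx
    rcases ((WithTop.coe_le_coe.2 hyx).trans hxbid).eq_or_lt with h1 | h1
    · rw [heq b' hr' hcount (hbs'.trans h1.symm)]
      rw [← h1, WithTop.coe_le_coe] at hxbid
      rw [le_antisymm hxbid hyx, sub_self, zero_div]
    · exact hgt b' hr' (hbs' ▸ h1)
  by_cases hlow : ∃ i, 1 ≤ i ∧ i ≤ B.M ∧ y = B.lower i
  · obtain ⟨i, hi1, hiM, rfl⟩ := hlow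
    have hlt : ∀ c : Fin n → WithTop ℝ, rivalBid c s = rivalBid b s →
        rivalCount c s = rivalCount b s → B.Permissible (c s) →
        c s < (B.lower i : WithTop ℝ) → 2 ≤ i ∧
          B.payoff c s x = (B.lower i - x) / (κ + 1) + κ * (B.upper (i - 1) - x) / (κ + 1) := by
      intro c hc hcc hcp hcs
      obtain ⟨h2, hpay⟩ := hB.payment_of_lt_lower hi1 hiM (hc.trans hy.symm) hcs hcp
      refine ⟨h2, ?_⟩
      rw [payoff, winProb_of_lt_rivalBid (by rwa [hc, ← hy]), hpay, hcc]
      field_simp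
      ring
    rcases le_or_gt (B.lower i) x with hx | hx
    · rw [hhigh hx]
      rcases lt_trichotomy (b s) (B.lower i : WithTop ℝ) with h1 | h1 | h1
      · obtain ⟨h2, h3⟩ := hlt b rfl rfl (hperm s) h1
        have h4 := hB.upper_lt_lower (i := i - 1) (by omega) (by omega) hiM
        rw [h3]
        exact add_nonpos (div_nonpos_of_nonpos_of_nonneg (by linarith) hκ1.le)
          (div_nonpos_of_nonpos_of_nonneg
            (mul_nonpos_of_nonneg_of_nonpos (by linarith) (by linarith)) hκ1.le)
      · rw [heq b rfl rfl h1]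
        exact div_nonpos_of_nonpos_of_nonneg (by linarith) hκ1.le
      · rw [hgt b rfl h1]
    · have hpos : 0 ≤ (B.lower i - x) / (κ + 1) := div_nonneg (by linarith) hκ1.le
      by_cases hprev : 2 ≤ i ∧ x < B.upper (i - 1)
      · obtain ⟨h2, hxu⟩ := hprev
        have hbl : b' s < (B.lower i : WithTop ℝ) := by
          rw [hbs']
          refine (hB.bid_le (by omega) (by omega) hxu).trans_lt (WithTop.coe_lt_coe.2 ?_)
          exact max_lt hx (hB.lower_strictMono (by omega) (by omega) hiM)
        rw [(hlt b' hr' hcount hperm' hbl).2]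
        have hpos' : 0 ≤ κ * (B.upper (i - 1) - x) / (κ + 1) :=
          div_nonneg (mul_nonneg (by linarith) (by linarith)) hκ1.le
        rcases lt_trichotomy (b s) (B.lower i : WithTop ℝ) with h1 | h1 | h1
        · rw [(hlt b rfl rfl (hperm s) h1).2]
        · rw [heq b rfl rfl h1]
          linarith
        · rw [hgt b rfl h1]
          linarith
      · have hxu : x < B.upper i := hx.trans_le (hB.lower_le_upper i hi1 hiM)
        obtain ⟨l, hl1, hlM, hxl, hlmin, hbl⟩ :=
          hB.exists_bid_eq (hxu.trans_le (hB.upper_mono hi1 hiM le_rfl))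
        have hli : l = i := by
          rcases lt_trichotomy l i with h1 | h1 | h1
          · exact (hprev ⟨by omega,
              hxl.trans_le (hB.upper_mono hl1 (by omega) (by omega))⟩).elim
          · exact h1
          · exact ((hlmin i hi1 h1).not_gt hxu).elim
        subst hli
        rw [max_eq_right hx.le] at hbl
        rw [heq b' hr' hcount (hbs'.trans hbl)]
        rcases lt_trichotomy (b s) (B.lower l : WithTop ℝ) with h1 | h1 | h1
        · obtain ⟨h2, h3⟩ := hlt b rfl rfl (hperm s) h1
          have h4 : B.upper (l - 1) ≤ x := by
            by_contra hcon
            exact hprev ⟨h2, not_le.1 hcon⟩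
          rw [h3]
          have : κ * (B.upper (l - 1) - x) / (κ + 1) ≤ 0 :=
            div_nonpos_of_nonpos_of_nonneg
              (mul_nonpos_of_nonneg_of_nonpos (by linarith) (by linarith)) hκ1.le
          linarith
        · rw [heq b rfl rfl h1]
        · rw [hgt b rfl h1]
          exact hpos
  · push Not at hlow
    have hlt : ∀ c : Fin n → WithTop ℝ, rivalBid c s = rivalBid b s → c s < (y : WithTop ℝ) →
        B.payoff c s x = y - x := by
      intro c hc hcs
      rw [payoff, winProb_of_lt_rivalBid (by rwa [hc, ← hy]), payment_of_forall_ne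
        (fun i h1 h2 => ?_) (hc ▸ htop), hc, ← hy, WithTop.untopD_coe, one_mul]
      rw [hc, ← hy]
      exact fun h => hlow i h1 h2 (WithTop.coe_injective h)
    rcases le_or_gt y x with hx | hx
    · rw [hhigh hx]
      rcases lt_trichotomy (b s) (y : WithTop ℝ) with h1 | h1 | h1
      · rw [hlt b rfl h1]
        linarith
      · rw [heq b rfl rfl h1]
        exact div_nonpos_of_nonpos_of_nonneg (by linarith) hκ1.le
      · rw [hgt b rfl h1]
    · have hbl : b' s < (y : WithTop ℝ) := by
        rw [hbs']
        refine (hB.bid_le hj1 hjM (hx.trans_le hjhi)).trans_lt (WithTop.coe_lt_coe.2 ?_)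
        exact max_lt hx (lt_of_le_of_ne hjlo (hlow j hj1 hjM).symm)
      rw [hlt b' hr' hbl]
      rcases lt_trichotomy (b s) (y : WithTop ℝ) with h1 | h1 | h1
      · rw [hlt b rfl h1]
      · rw [heq b rfl rfl h1, div_le_iff₀ hκ1]
        nlinarith
      · rw [hgt b rfl h1]
        linarith

lemma Valid.bidWeaklyDominant (hB : B.Valid) (n : ℕ) : B.BidWeaklyDominant n :=
  fun _ x _ => ⟨hB.permissible_bid x, fun _ hb => hB.payoff_le hb x⟩

end BRA

namespace BRA

variable {B : BRA} {n : ℕ}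

/-! ### Bounds and measurability for the induced direct mechanism -/

lemma winProb_nonneg (b : Fin n → WithTop ℝ) (s : Fin n) : 0 ≤ winProb b s := by
  unfold winProb
  split_ifs <;> positivity

lemma winProb_eq_zero_of_forall_top {b : Fin n → WithTop ℝ} (h : ∀ k, b k = ⊤) (s : Fin n) :
    winProb b s = 0 := winProb_of_top (h s)

lemma sum_winProb {b : Fin n → WithTop ℝ} (h : ∃ k, b k ≠ ⊤) : ∑ s, winProb b s = 1 := by
  obtain ⟨k₀, hk₀⟩ := h
  obtain ⟨s₀, -, hs₀⟩ := Finset.exists_min_image Finset.univ b ⟨k₀, Finset.mem_univ _⟩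
  have htop : b s₀ ≠ ⊤ := ne_top_of_le_ne_top hk₀ (hs₀ k₀ (Finset.mem_univ _))
  have hwin : ∀ s, winProb b s = if b s = b s₀ then
      1 / ((Finset.univ.filter fun k => b k = b s₀).card : ℝ) else 0 := by
    intro s
    by_cases hs : b s = b s₀
    · rw [winProb, if_pos ⟨hs ▸ htop, fun k => hs ▸ hs₀ k (Finset.mem_univ _)⟩, if_pos hs, hs]
    · rw [winProb, if_neg, if_neg hs]
      exact fun hcon => hs (le_antisymm (hcon.2 s₀) (hs₀ s (Finset.mem_univ _)))
  simp only [hwin]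
  rw [← Finset.sum_filter, Finset.sum_const, nsmul_eq_mul]
  have : ((Finset.univ.filter fun k => b k = b s₀).card : ℝ) ≠ 0 := by
    have : 0 < (Finset.univ.filter fun k => b k = b s₀).card :=
      Finset.card_pos.2 ⟨s₀, by simp⟩
    positivity
  field_simp

lemma sum_winProb_le (b : Fin n → WithTop ℝ) : ∑ s, winProb b s ≤ 1 := by
  by_cases h : ∃ k, b k ≠ ⊤
  · exact (sum_winProb h).le
  · push Not at h
    simp [winProb_eq_zero_of_forall_top h]

lemma winProb_le_one (b : Fin n → WithTop ℝ) (s : Fin n) : winProb b s ≤ 1 :=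
  (Finset.single_le_sum (fun k _ => winProb_nonneg b k) (Finset.mem_univ s)).trans
    (sum_winProb_le b)

lemma Valid.payment_mem (hB : B.Valid) {b : Fin n → WithTop ℝ} (hb : ∀ k, B.Permissible (b k))
    (s : Fin n) : B.payment b s ∈ Icc (0 : ℝ) 1 := by
  by_cases hred : ∃ j, B.Reduces b s j
  · obtain ⟨j, hj⟩ := hred
    rw [hB.payment_of_reduces hj]
    obtain ⟨i, hi, -, hij, hjM, -⟩ := hj
    have h1 := hi.1
    have hl := hB.lower_nonneg (i := j) (by omega) hjM
    have hl' := (hB.lower_le_upper j (by omega) hjM).trans (hB.upper_le_one (by omega) hjM)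
    have hu := hB.upper_nonneg (i := j - 1) (by omega) (by omega)
    have hu' := hB.upper_le_one (i := j - 1) (by omega) (by omega)
    set κ : ℝ := ((Finset.univ.filter fun l => b l = (B.lower j : WithTop ℝ)).card : ℝ)
    have hκ : 0 ≤ κ := Nat.cast_nonneg _
    refine ⟨by positivity, ?_⟩
    rw [div_le_one (by positivity)]
    nlinarith
  · rw [payment_of_not_reduces (not_exists.1 hred)]
    rcases eq_or_ne (rivalBid b s) ⊤ with htop | htop
    · rw [htop, WithTop.untopD_top]
      exact ⟨hB.upper_nonneg hB.one_le le_rfl, hB.le_one⟩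
    · obtain ⟨k, hk, heq⟩ := exists_rivalBid_eq htop
      obtain ⟨i, hi1, hiM, hlo, hhi⟩ := (hb k).resolve_left (heq ▸ htop)
      obtain ⟨y, hy⟩ := WithTop.ne_top_iff_exists.1 htop
      rw [heq, ← hy, WithTop.coe_le_coe] at hlo hhi
      rw [← hy, WithTop.untopD_coe]
      exact ⟨(hB.lower_nonneg hi1 hiM).trans hlo, hhi.trans (hB.upper_le_one hi1 hiM)⟩

section Measurability

variable {α : Type*} [MeasurableSpace α] {b : α → Fin n → WithTop ℝ}

lemma measurable_card_eq (hb : ∀ k, Measurable fun a => b a k) {c : α → WithTop ℝ}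
    (hc : Measurable c) :
    Measurable fun a => ((Finset.univ.filter fun k => b a k = c a).card : ℝ) := by
  simp only [Finset.card_filter, Nat.cast_sum]
  refine Finset.measurable_sum _ fun k _ => ?_
  simp only [Nat.cast_ite, Nat.cast_one, Nat.cast_zero]
  exact Measurable.ite (measurableSet_eq_fun (hb k) hc) measurable_const measurable_const

lemma measurable_winProb (hb : ∀ k, Measurable fun a => b a k) (s : Fin n) :
    Measurable fun a => winProb (b a) s := by
  unfold winProb
  refine Measurable.ite (Measurable.setOf (Measurable.and ?_ (Measurable.forall fun k => ?_)))
    ((measurable_const).div (measurable_card_eq hb (hb s))) measurable_const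
  · exact Measurable.not (measurableSet_setOfPred.1 (measurableSet_eq_fun (hb s) measurable_const))
  · exact measurableSet_setOfPred.1 (measurableSet_le (hb s) (hb k))

lemma measurable_rivalBid (hb : ∀ k, Measurable fun a => b a k) (s : Fin n) :
    Measurable fun a => rivalBid (b a) s := by
  unfold rivalBid
  induction (Finset.univ.erase s) using Finset.induction_on with
  | empty => simp
  | insert k t _ ih =>
    simp only [Finset.inf_insert]
    exact (hb k).inf ih

lemma measurable_inInterval (hb : ∀ k, Measurable fun a => b a k) (i : ℕ) (k : Fin n) :
    Measurable fun a => B.InInterval i (b a k) := by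
  unfold InInterval
  exact measurable_const.and (measurable_const.and
    ((measurableSet_setOfPred.1 (measurableSet_le measurable_const (hb k))).and
      (measurableSet_setOfPred.1 (measurableSet_le (hb k) measurable_const))))

lemma measurableSet_reduces (hb : ∀ k, Measurable fun a => b a k) (s : Fin n) (j : ℕ) :
    MeasurableSet {a | B.Reduces (b a) s j} := by
  refine Measurable.setOf ?_
  unfold Reduces
  refine Measurable.exists fun i => (measurable_inInterval hb i s).and (Measurable.and ?_
    (measurable_const.and (measurable_const.and ?_)))
  · exact Measurable.forall fun k => measurable_const.imp (measurable_inInterval hb i k).not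
  · exact measurableSet_setOfPred.1 (measurableSet_eq_fun
      ((measurable_rivalBid hb s).untopD (B.upper B.M)) measurable_const)

/-- The payment as a finite sum, in which at most one summand does not vanish. -/
lemma Valid.payment_eq_sum (hB : B.Valid) (b : Fin n → WithTop ℝ) (s : Fin n) :
    B.payment b s = (rivalBid b s).untopD (B.upper B.M) + ∑ j ∈ Finset.range (B.M + 1),
      if B.Reduces b s j then
        (B.lower j + ((Finset.univ.filter fun l => b l = (B.lower j : WithTop ℝ)).card
          : ℝ) * B.upper (j - 1)) /
          (((Finset.univ.filter fun l => b l = (B.lower j : WithTop ℝ)).card : ℝ) + 1)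
          - (rivalBid b s).untopD (B.upper B.M)
      else 0 := by
  by_cases hred : ∃ j, B.Reduces b s j
  · obtain ⟨j, hj⟩ := hred
    obtain ⟨i, hi, -, hlt, hM, heq⟩ := id hj
    rw [Finset.sum_eq_single_of_mem j (Finset.mem_range.2 (by omega)), if_pos hj,
      hB.payment_of_reduces hj, add_sub_cancel]
    intro j' _ hne
    refine if_neg ?_
    rintro ⟨i', hi', -, hlt', hM', heq'⟩
    exact hne (hB.lower_inj (by omega) hM' (by omega) hM (heq'.symm.trans heq))
  · have hall := not_exists.1 hred
    rw [payment_of_not_reduces hall, Finset.sum_eq_zero fun j _ => if_neg (hall j), add_zero]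

lemma Valid.measurable_payment (hB : B.Valid) (hb : ∀ k, Measurable fun a => b a k) (s : Fin n) :
    Measurable fun a => B.payment (b a) s := by
  simp only [hB.payment_eq_sum]
  have hr := (measurable_rivalBid hb s).untopD (B.upper B.M)
  refine hr.add (Finset.measurable_sum _ fun j _ => ?_)
  have hc := measurable_card_eq hb (c := fun _ => (B.lower j : WithTop ℝ)) measurable_const
  exact Measurable.ite (measurableSet_reduces hb s j)
    (((measurable_const.add (hc.mul_const _)).div (hc.add_const 1)).sub hr) measurable_const

end Measurability

/-! ### Incentives in the induced direct mechanism -/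

section Direct

variable {f v : ℝ → ℝ} (h : Primitives f v) (hB : B.Valid)
include h hB

omit h in
lemma Valid.measurable_bid_profile (k : Fin n) : Measurable fun q : Fin n → ℝ => B.bid (q k) :=
  hB.bid_mono.measurable.comp (measurable_pi_apply k)

omit h in
lemma Valid.measurable_toDirect_t (s : Fin n) : Measurable ((B.toDirect n).t s) :=
  (measurable_winProb hB.measurable_bid_profile s).mul
    (hB.measurable_payment hB.measurable_bid_profile s)

omit h in
lemma Valid.abs_toDirect_t_le (s : Fin n) (q : Fin n → ℝ) : ‖(B.toDirect n).t s q‖ ≤ 1 := by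
  have h1 := hB.payment_mem (b := fun k => B.bid (q k)) (fun k => hB.permissible_bid _) s
  have h2 := winProb_nonneg (fun k => B.bid (q k)) s
  have h3 := winProb_le_one (fun k => B.bid (q k)) s
  change ‖winProb _ s * B.payment _ s‖ ≤ 1
  rw [Real.norm_of_nonneg (mul_nonneg h2 h1.1)]
  exact mul_le_one₀ h3 h1.1 h1.2

lemma feasible_toDirect : (B.toDirect n).Feasible f := by
  have := h.isProbabilityMeasure_profileLaw (n := n)
  refine ⟨fun s => measurable_winProb hB.measurable_bid_profile s, hB.measurable_toDirect_t,
    fun s => ?_, fun s r _ => ?_,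
    fun s q _ => ⟨winProb_nonneg (fun k => B.bid (q k)) s, winProb_le_one (fun k => B.bid (q k)) s⟩,
    fun q _ => sum_winProb_le fun k => B.bid (q k)⟩
  · exact Integrable.of_bound (hB.measurable_toDirect_t s).aestronglyMeasurable 1
      (Eventually.of_forall (hB.abs_toDirect_t_le s))
  · refine Integrable.of_bound (Measurable.aestronglyMeasurable ?_) 1
      (Eventually.of_forall fun q => hB.abs_toDirect_t_le s _)
    exact (hB.measurable_toDirect_t s).comp
      ((measurable_update_pair s).comp (measurable_const.prodMk measurable_id))

lemma integrable_payoff (s : Fin n) {r : ℝ} (hr : r ∈ Icc (0 : ℝ) 1) (x : ℝ) :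
    Integrable (fun q => B.payoff (fun k => B.bid (Function.update q s r k)) s x)
      (profileLaw f n) := by
  have hm := feasible_toDirect (n := n) h hB
  have := (hm.integrable_interim s r hr).sub ((h.integrable_p_update hm s hr).const_mul x)
  refine this.congr (Eventually.of_forall fun q => ?_)
  simp only [Pi.sub_apply, toDirect, payoff]
  ring

lemma sellerPayoff_toDirect (s : Fin n) {r : ℝ} (hr : r ∈ Icc (0 : ℝ) 1) (x : ℝ) :
    (B.toDirect n).sellerPayoff f s r x
      = ∫ q, B.payoff (fun k => B.bid (Function.update q s r k)) s x ∂(profileLaw f n) := by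
  have hm := feasible_toDirect (n := n) h hB
  rw [DirectMechanism.sellerPayoff, DirectMechanism.interimT, DirectMechanism.interimP,
    ← integral_const_mul, ← integral_sub (hm.integrable_interim s r hr)
      ((h.integrable_p_update hm s hr).const_mul x)]
  refine integral_congr_ae (Eventually.of_forall fun q => ?_)
  simp only [toDirect, payoff]
  ring

omit h hB in
lemma bid_comp_update (q : Fin n → ℝ) (s : Fin n) (r : ℝ) :
    (fun k => B.bid (Function.update q s r k))
      = Function.update (fun k => B.bid (q k)) s (B.bid r) := by
  ext k
  rcases eq_or_ne k s with rfl | hk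
  · simp
  · simp [hk]

lemma incentiveCompatible_toDirect (s : Fin n) {x r : ℝ} (hx : x ∈ Icc (0 : ℝ) 1)
    (hr : r ∈ Icc (0 : ℝ) 1) :
    (B.toDirect n).sellerPayoff f s r x ≤ (B.toDirect n).sellerPayoff f s x x := by
  rw [sellerPayoff_toDirect h hB s hr, sellerPayoff_toDirect h hB s hx]
  refine integral_mono (integrable_payoff h hB s hr x) (integrable_payoff h hB s hx x) fun q => ?_
  have := hB.payoff_le (b := fun k => B.bid (Function.update q s r k)) (s := s)
    (fun k => hB.permissible_bid _) x
  simp only [bid_comp_update, Function.update_idem] at this ⊢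
  exact this

lemma individuallyRational_toDirect (s : Fin n) {x : ℝ} (hx : x ∈ Icc (0 : ℝ) 1) :
    0 ≤ (B.toDirect n).sellerPayoff f s x x := by
  rw [sellerPayoff_toDirect h hB s hx]
  refine integral_nonneg fun q => ?_
  have := hB.payoff_le (b := Function.update (fun k => B.bid (q k)) s ⊤) (s := s)
    (fun k => by
      rcases eq_or_ne k s with rfl | hk
      · rw [Function.update_self]
        exact Or.inl rfl
      · simpa [hk] using hB.permissible_bid _) x
  rw [payoff_eq_zero_of_winProb (winProb_of_top (by simp)), Function.update_idem] at this
  simp only [bid_comp_update, Pi.zero_apply]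
  exact this

lemma sellerPayoff_toDirect_one (s : Fin n) : (B.toDirect n).sellerPayoff f s 1 1 = 0 := by
  rw [sellerPayoff_toDirect h hB s (by simp)]
  refine integral_eq_zero_of_ae (Eventually.of_forall fun q => ?_)
  refine payoff_eq_zero_of_winProb (winProb_of_top ?_)
  simp only [Function.update_self]
  exact Valid.bid_eq_top hB.le_one

end Direct

/-- Awarding the contract to the lowest bidder maximizes the winner's weight, if weights are
decreasing in bids, non-negative for participants and non-positive for those who stay out. -/
lemma sum_mul_le_sum_mul_winProb {b : Fin n → WithTop ℝ} {w p : Fin n → ℝ} (hp : ∀ s, 0 ≤ p s)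
    (hp1 : ∑ s, p s ≤ 1) (hmono : ∀ s k, b s ≠ ⊤ → b s ≤ b k → w k ≤ w s)
    (hin : ∀ s, b s ≠ ⊤ → 0 ≤ w s) (hout : ∀ s, b s = ⊤ → w s ≤ 0) :
    ∑ s, w s * p s ≤ ∑ s, w s * winProb b s := by
  by_cases hb : ∃ k, b k ≠ ⊤
  · obtain ⟨k₀, hk₀⟩ := id hb
    obtain ⟨s₀, -, hs₀⟩ := Finset.exists_min_image Finset.univ b ⟨k₀, Finset.mem_univ _⟩
    have htop : b s₀ ≠ ⊤ := ne_top_of_le_ne_top hk₀ (hs₀ k₀ (Finset.mem_univ _))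
    calc ∑ s, w s * p s ≤ ∑ s, w s₀ * p s := Finset.sum_le_sum fun s _ =>
          mul_le_mul_of_nonneg_right (hmono s₀ s htop (hs₀ s (Finset.mem_univ _))) (hp s)
      _ = w s₀ * ∑ s, p s := (Finset.mul_sum _ _ _).symm
      _ ≤ w s₀ * ∑ s, winProb b s := by
          rw [sum_winProb hb]
          exact mul_le_mul_of_nonneg_left hp1 (hin s₀ htop)
      _ = ∑ s, w s₀ * winProb b s := Finset.mul_sum _ _ _
      _ = ∑ s, w s * winProb b s := by
          refine Finset.sum_congr rfl fun s _ => ?_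
          by_cases hs : b s ≠ ⊤ ∧ ∀ k, b s ≤ b k
          · rw [le_antisymm (hmono s s₀ hs.1 (hs.2 s₀)) (hmono s₀ s htop (hs₀ s (Finset.mem_univ _)))]
          · rw [winProb, if_neg hs, mul_zero, mul_zero]
  · push Not at hb
    simp only [winProb_eq_zero_of_forall_top hb, mul_zero, Finset.sum_const_zero]
    exact Finset.sum_nonpos fun s _ => mul_nonpos_of_nonpos_of_nonneg (hout s (hb s)) (hp s)

end BRA

/-! ### Auctions adapted to pooling intervals -/

lemma BRA.Valid.bid_eq_lower {B : BRA} (hB : B.Valid) {j : ℕ} (hj : 1 ≤ j) (hjM : j ≤ B.M) {x : ℝ}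
    (hprev : 2 ≤ j → B.upper (j - 1) ≤ x) (hx : x < B.lower j) :
    B.bid x = (B.lower j : WithTop ℝ) := by
  have hxu : x < B.upper j := hx.trans_le (hB.lower_le_upper j hj hjM)
  obtain ⟨i, hi1, hiM, hxi, hmin, heq⟩ :=
    hB.exists_bid_eq (hxu.trans_le (hB.upper_mono hj hjM le_rfl))
  have hij : i = j := by
    rcases lt_trichotomy i j with h | h | h
    · have h1 := hB.upper_mono (i := i) (j := j - 1) hi1 (by omega) (by omega)
      linarith [hprev (by omega)]
    · exact h
    · exact ((hmin j hj h).not_gt hxu).elim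
  rw [heq, hij, max_eq_right hx.le]

/-- The gap below the bid interval `j` is the image under `F⁻¹` of the pooling interval
`[lo i, hi i)`; below the first bid interval, the gap starts at `0`. -/
structure GapOf (f : ℝ → ℝ) (B : BRA) (lo hi : ℕ → ℝ) (j i : ℕ) : Prop where
  lower_eq : B.lower j = quantile f (hi i)
  first : j = 1 → lo i = 0
  upper_eq : 2 ≤ j → B.upper (j - 1) = quantile f (lo i)

/-- The bid intervals of `B` are the images under `F⁻¹` of the complement of the pooling intervals
in `[0, S̄]`. -/
structure Adapted (f v : ℝ → ℝ) (B : BRA) (L : ℕ) (lo hi : ℕ → ℝ) : Prop where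
  valid : B.Valid
  top : B.upper B.M = quantile f (exclusionCutoff f v)
  exists_gap : ∀ i, 1 ≤ i → i ≤ L → ∃ j, 1 ≤ j ∧ j ≤ B.M ∧ GapOf f B lo hi j i
  exists_pool : ∀ j, 1 ≤ j → j ≤ B.M → (j = 1 ∧ B.lower 1 = 0) ∨
    ∃ i, 1 ≤ i ∧ i ≤ L ∧ GapOf f B lo hi j i

namespace IsPooling

variable {f v : ℝ → ℝ} {L : ℕ} {lo hi : ℕ → ℝ} (hpool : IsPooling f v L lo hi)
include hpool

lemma hi_mem {i : ℕ} (h1 : 1 ≤ i) (h2 : i ≤ L) : hi i ∈ Icc (0 : ℝ) 1 :=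
  ⟨(hpool.nonneg i h1 h2).trans (hpool.lo_lt_hi i h1 h2).le,
    (hpool.hi_le i h1 h2).trans (exclusionCutoff_le_one f v)⟩

lemma lo_mem {i : ℕ} (h1 : 1 ≤ i) (h2 : i ≤ L) : lo i ∈ Icc (0 : ℝ) 1 :=
  ⟨hpool.nonneg i h1 h2, (hpool.lo_lt_hi i h1 h2).le.trans (hpool.hi_mem h1 h2).2⟩

/-- Both forms of the auction built from the pooling intervals are adapted to them: they differ in
whether the first pooling interval starts at `0`, so that the lowest bid is made by a whole pool. -/
lemma adapted_poolingBRA (h : Primitives f v) : Adapted f v (poolingBRA f v L lo hi) L lo hi := by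
  have hq := h.strictMonoOn_quantile
  have hS := exclusionCutoff_mem f v
  have hlohi : ∀ i, 1 ≤ i → i ≤ L → quantile f (lo i) < quantile f (hi i) := fun i h1 h2 =>
    hq (hpool.lo_mem h1 h2) (hpool.hi_mem h1 h2) (hpool.lo_lt_hi i h1 h2)
  have hhilo : ∀ i, 1 ≤ i → i < L → quantile f (hi i) ≤ quantile f (lo (i + 1)) := fun i h1 h2 =>
    hq.monotoneOn (hpool.hi_mem h1 h2.le) (hpool.lo_mem (by omega) (by omega))
      (hpool.ordered i h1 h2)
  have hhiS : ∀ i, 1 ≤ i → i ≤ L → quantile f (hi i) ≤ quantile f (exclusionCutoff f v) :=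
    fun i h1 h2 => hq.monotoneOn (hpool.hi_mem h1 h2) hS (hpool.hi_le i h1 h2)
  unfold poolingBRA
  split_ifs with hcase
  · obtain ⟨hL, hlo1⟩ := hcase
    refine ⟨⟨hL, ?_, ?_, fun i h1 h2 => ?_, fun i h1 h2 => ?_⟩, ?_, fun i h1 h2 => ?_,
      fun j h1 h2 => ?_⟩
    · exact (h.quantile_mem (hpool.hi_mem le_rfl hL)).1
    · simpa using (h.quantile_mem hS).2
    · dsimp only at h2 ⊢
      split_ifs with hi'
      · exact hhilo i h1 hi'
      · exact hhiS i h1 h2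
    · dsimp only at h2 ⊢
      rw [if_pos h2]
      exact hlohi (i + 1) (by omega) h2
    · simp
    · refine ⟨i, h1, h2, rfl, ?_, fun h3 => ?_⟩
      · rintro rfl
        exact hlo1
      · have e1 : i - 1 < L := by omega
        have e2 : i - 1 + 1 = i := by omega
        simp [e1, e2]
    · refine Or.inr ⟨j, h1, h2, rfl, ?_, fun h3 => ?_⟩
      · rintro rfl
        exact hlo1
      · dsimp only at h2 ⊢
        have e1 : j - 1 < L := by omega
        have e2 : j - 1 + 1 = j := by omega
        simp [e1, e2]
  · refine ⟨⟨by simp, by simp, ?_, fun i h1 h2 => ?_, fun i h1 h2 => ?_⟩, ?_, fun i h1 h2 => ?_,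
      fun j h1 h2 => ?_⟩
    · simpa using (h.quantile_mem hS).2
    · dsimp only at h2 ⊢
      rcases eq_or_ne i 1 with rfl | hne
      · rw [if_pos rfl]
        split_ifs with h3
        · exact (h.quantile_mem (hpool.lo_mem h1 h3)).1
        · exact (h.quantile_mem hS).1
      · rw [if_neg hne]
        split_ifs with h3
        · have := hhilo (i - 1) (by omega) (by omega)
          rwa [Nat.sub_add_cancel h1] at this
        · exact hhiS (i - 1) (by omega) (by omega)
    · dsimp only at h2 ⊢
      rw [if_pos (by omega), if_neg (by omega), Nat.add_sub_cancel]
      exact hlohi i h1 (by omega)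
    · simp
    · refine ⟨i + 1, by omega, by simpa using h2, ?_, by omega, fun _ => ?_⟩
      · simp [show i ≠ 0 by omega]
      · simp [h2]
    · dsimp only at h2 ⊢
      rcases eq_or_ne j 1 with rfl | hne
      · exact Or.inl ⟨rfl, by simp⟩
      · refine Or.inr ⟨j - 1, by omega, by omega, by simp [hne], fun h3 => absurd h3 hne,
          fun _ => ?_⟩
        have : j ≤ L + 1 := h2
        simp [this]

end IsPooling

lemma BRA.interimP_toDirect_congr {f : ℝ → ℝ} {B : BRA} {n : ℕ} (s : Fin n) {x y : ℝ}
    (heq : B.bid x = B.bid y) :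
    (B.toDirect n).interimP f s x = (B.toDirect n).interimP f s y := by
  simp only [DirectMechanism.interimP, BRA.toDirect, BRA.bid_comp_update, heq]

namespace Adapted

variable {f v : ℝ → ℝ} {B : BRA} {L : ℕ} {lo hi : ℕ → ℝ} {n : ℕ}
  (hA : Adapted f v B L lo hi) (hpool : IsPooling f v L lo hi) (h : Primitives f v)
include hA h

omit hpool in
lemma bid_eq_top_iff_cutoff_le {x : ℝ} (hx : x ∈ Icc (0 : ℝ) 1) :
    B.bid x = ⊤ ↔ exclusionCutoff f v ≤ cdf f x := by
  rw [hA.valid.bid_eq_top_iff, hA.top, h.quantile_le_iff hx (exclusionCutoff_mem f v)]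

include hpool

/-- All qualities in a pooling interval bid the same. -/
lemma bid_eq_of_mem_pool {i : ℕ} (h1 : 1 ≤ i) (h2 : i ≤ L) {x y : ℝ} (hx : x ∈ Icc (0 : ℝ) 1)
    (hy : y ∈ Icc (0 : ℝ) 1) (hxi : cdf f x ∈ Ico (lo i) (hi i))
    (hyi : cdf f y ∈ Ico (lo i) (hi i)) : B.bid x = B.bid y := by
  obtain ⟨j, hj1, hjM, hgap⟩ := hA.exists_gap i h1 h2
  have key : ∀ z ∈ Icc (0 : ℝ) 1, cdf f z ∈ Ico (lo i) (hi i) →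
      B.bid z = (B.lower j : WithTop ℝ) := by
    intro z hz hzi
    refine hA.valid.bid_eq_lower hj1 hjM (fun h2j => ?_) ?_
    · rw [hgap.upper_eq h2j, h.quantile_le_iff hz (hpool.lo_mem h1 h2)]
      exact hzi.1
    · rw [hgap.lower_eq, h.lt_quantile_iff hz (hpool.hi_mem h1 h2)]
      exact hzi.2
  rw [key x hx hxi, key y hy hyi]

/-- Distinct qualities that make the same bid are in the same pooling interval, except that the
quality equal to a lower endpoint also bids this endpoint. -/
lemma exists_pool_of_bid_eq {x y : ℝ} (hx : x ∈ Icc (0 : ℝ) 1) (hy : y ∈ Icc (0 : ℝ) 1)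
    (hyx : y < x) (heq : B.bid x = B.bid y) (htop : B.bid x ≠ ⊤)
    (hne : ∀ j, 1 ≤ j → j ≤ B.M → x ≠ B.lower j) :
    ∃ i, 1 ≤ i ∧ i ≤ L ∧ cdf f x ∈ Ico (lo i) (hi i) ∧ cdf f y ∈ Ico (lo i) (hi i) := by
  have hB := hA.valid
  have hxM : x < B.upper B.M := by
    by_contra hcon
    exact htop (BRA.Valid.bid_eq_top (not_lt.1 hcon))
  obtain ⟨j, hj1, hjM, hxj, -, hbx⟩ := hB.exists_bid_eq hxM
  obtain ⟨l, hl1, hlM, hyl, hlmin, hby⟩ := hB.exists_bid_eq (hyx.trans hxM)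
  rw [hbx, hby, WithTop.coe_inj] at heq
  have hlj : l = j := by
    rcases lt_trichotomy l j with hlt | hlt | hlt
    · have h1 := hB.upper_lt_lower hl1 hlt hjM
      have h2 : max y (B.lower l) ≤ B.upper l := max_le hyl.le (hB.lower_le_upper l hl1 hlM)
      linarith [le_max_right x (B.lower j)]
    · exact hlt
    · have h1 := hB.upper_lt_lower hj1 hlt hlM
      have h2 : max x (B.lower j) ≤ B.upper j := max_le hxj.le (hB.lower_le_upper j hj1 hjM)
      linarith [le_max_right y (B.lower l)]
  subst hlj
  have hxl : x < B.lower l := by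
    refine lt_of_le_of_ne ?_ (hne l hl1 hlM)
    by_contra hcon
    push Not at hcon
    rw [max_eq_left hcon.le] at heq
    rcases max_choice y (B.lower l) with h1 | h1 <;> rw [h1] at heq <;> linarith
  rcases hA.exists_pool l hl1 hlM with ⟨rfl, h0⟩ | ⟨i, hi1, hiL, hgap⟩
  · linarith [hx.1]
  · have hlo : ∀ z ∈ Icc (0 : ℝ) 1, y ≤ z → lo i ≤ cdf f z := by
      intro z hz hyz
      rcases hl1.eq_or_lt with h1 | h1
      · rw [hgap.first h1.symm]
        exact (h.cdf_mem hz).1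
      · rw [← h.quantile_le_iff hz (hpool.lo_mem hi1 hiL), ← hgap.upper_eq h1]
        exact (hlmin (l - 1) (by omega) (by omega)).trans hyz
    have hhi : ∀ z ∈ Icc (0 : ℝ) 1, z ≤ x → cdf f z < hi i := by
      intro z hz hzx
      rw [← h.lt_quantile_iff hz (hpool.hi_mem hi1 hiL), ← hgap.lower_eq]
      exact hzx.trans_lt hxl
    exact ⟨i, hi1, hiL, ⟨hlo x hx hyx.le, hhi x hx le_rfl⟩, ⟨hlo y hy le_rfl, hhi y hy hyx.le⟩⟩

/-- Lower bids come from qualities with higher ironed surplus. -/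
lemma ironedSurplus_le_of_bid_le {x y : ℝ} (hx : x ∈ Ioo (0 : ℝ) 1) (hy : y ∈ Ioo (0 : ℝ) 1)
    (hne : ∀ j, 1 ≤ j → j ≤ B.M → x ≠ B.lower j) (htop : B.bid x ≠ ⊤) (hle : B.bid x ≤ B.bid y) :
    ironedSurplus f v (cdf f y) ≤ ironedSurplus f v (cdf f x) := by
  rcases le_or_gt x y with hxy | hxy
  · exact h.antitoneOn_ironedSurplus_cdf hx hy hxy
  · have heq := le_antisymm hle (hA.valid.bid_mono hxy.le)
    obtain ⟨i, hi1, hiL, hxi, hyi⟩ := hA.exists_pool_of_bid_eq hpool h (Ioo_subset_Icc_self hx)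
      (Ioo_subset_Icc_self hy) hxy heq htop hne
    obtain ⟨a, c, hac⟩ := hpool.affine i hi1 hiL
    rw [ironedSurplus_eq_of_affine hac hxi, ironedSurplus_eq_of_affine hac hyi]

omit hpool in
lemma ironedSurplus_nonneg_of_bid {x : ℝ} (hx : x ∈ Ioo (0 : ℝ) 1) (htop : B.bid x ≠ ⊤) :
    0 ≤ ironedSurplus f v (cdf f x) := by
  have hlt : cdf f x < exclusionCutoff f v := by
    rw [Ne, hA.bid_eq_top_iff_cutoff_le h (Ioo_subset_Icc_self hx)] at htop
    exact not_le.1 htop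
  have hF := h.cdf_mem_Ioo hx
  obtain ⟨t, ht, ht0, hxt, -⟩ := exists_lt_of_lt_exclusionCutoff hF.1.le hlt
  exact ht0.trans (h.antitoneOn_ironedSurplus hF ⟨hF.1.trans hxt, ht.2⟩ hxt.le)

omit hpool in
lemma ironedSurplus_nonpos_of_bid {x : ℝ} (hx : x ∈ Ioo (0 : ℝ) 1) (htop : B.bid x = ⊤)
    (hne : x ≠ B.upper B.M) : ironedSurplus f v (cdf f x) ≤ 0 := by
  have hxI := Ioo_subset_Icc_self hx
  rw [hA.bid_eq_top_iff_cutoff_le h hxI] at htop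
  have hF := h.cdf_mem_Ioo hx
  by_contra hcon
  push Not at hcon
  have hle : cdf f x ≤ exclusionCutoff f v :=
    le_csSup (bddAbove_cutoffSet f v) ⟨Ioo_subset_Ico_self hF, hcon.le⟩
  refine hne ?_
  rw [hA.top, le_antisymm htop hle, h.quantile_cdf hxI]

/-! ### Optimality -/

/-- Almost surely, no allocation of the contract yields more ironed surplus than the auction. -/
lemma ae_sum_ironedSurplus_le :
    ∀ᵐ q ∂(profileLaw f n), ∀ p : Fin n → ℝ, (∀ s, 0 ≤ p s) → ∑ s, p s ≤ 1 →
      ∑ s, ironedSurplus f v (cdf f (q s)) * p s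
        ≤ ∑ s, ironedSurplus f v (cdf f (q s)) * (B.toDirect n).p s q := by
  have hgood : ∀ᵐ x ∂(qualityLaw f), x ∈ Ioo (0 : ℝ) 1 ∧ x ≠ B.upper B.M ∧
      ∀ j : ℕ, x ≠ B.lower j := by
    filter_upwards [Primitives.ae_mem_Icc (f := f), Primitives.ae_ne (f := f) 0,
      Primitives.ae_ne (f := f) 1, Primitives.ae_ne (f := f) (B.upper B.M),
      eventually_countable_forall.2 fun j : ℕ => Primitives.ae_ne (f := f) (B.lower j)]
      with x hx h0 h1 hu hl
    exact ⟨⟨lt_of_le_of_ne hx.1 h0.symm, lt_of_le_of_ne hx.2 h1⟩, hu, hl⟩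
  filter_upwards [h.ae_profile hgood] with q hq p hp hp1
  exact BRA.sum_mul_le_sum_mul_winProb hp hp1
    (fun s k htop hle => hA.ironedSurplus_le_of_bid_le hpool h (hq s).1 (hq k).1
      (fun j _ _ => (hq s).2.2 j) htop hle)
    (fun s htop => hA.ironedSurplus_nonneg_of_bid h (hq s).1 htop)
    (fun s htop => hA.ironedSurplus_nonpos_of_bid h (hq s).1 htop (hq s).2.1)

/-- The interim winning probability jumps only where the cumulative surplus coincides with its
hull. -/
lemma coincide_of_isLUB (s : Fin n) {t c : ℝ} (ht : 0 ≤ t) (hc : c ∈ Icc (0 : ℝ) 1)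
    (hlub : IsLUB ({x | t < (B.toDirect n).interimP f s x} ∩ Icc 0 1) c) :
    ironedCumSurplus f v (cdf f c) = cumSurplus f v (cdf f c) := by
  have hS := exclusionCutoff_mem f v
  refine hpool.coincide _ ⟨(h.cdf_mem hc).1, ?_⟩ fun i hi1 hiL hci => ?_
  · rw [← h.le_quantile_iff hc hS]
    refine hlub.2 fun x hx => ?_
    rw [h.le_quantile_iff hx.2 hS]
    by_contra hcon
    push Not at hcon
    have htop := (hA.bid_eq_top_iff_cutoff_le h hx.2).2 hcon.le
    have hzero : (B.toDirect n).interimP f s x = 0 := by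
      simp only [DirectMechanism.interimP, BRA.toDirect, BRA.bid_comp_update, htop]
      exact integral_eq_zero_of_ae (Eventually.of_forall fun q => BRA.winProb_of_top (by simp))
    have hx1 : t < (B.toDirect n).interimP f s x := hx.1
    linarith
  · have hlo := hpool.lo_mem hi1 hiL
    have hhi := hpool.hi_mem hi1 hiL
    have h1 : quantile f (lo i) < c := by
      by_contra hcon
      rw [not_lt, h.le_quantile_iff hc hlo] at hcon
      exact hcon.not_gt hci.1
    have h2 : c < quantile f (hi i) := (h.lt_quantile_iff hc hhi).2 hci.2
    obtain ⟨x, hx, hxc⟩ := (lt_isLUB_iff hlub).1 h1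
    obtain ⟨y, hcy, hyhi⟩ := exists_between h2
    have hyI : y ∈ Icc (0 : ℝ) 1 := ⟨hc.1.trans hcy.le, hyhi.le.trans (h.quantile_mem hhi).2⟩
    have hxi : cdf f x ∈ Ico (lo i) (hi i) := by
      refine ⟨(h.quantile_le_iff hx.2 hlo).1 hxc.le, ?_⟩
      exact (h.lt_quantile_iff hx.2 hhi).1 ((hlub.1 hx).trans_lt h2)
    have hyi : cdf f y ∈ Ico (lo i) (hi i) :=
      ⟨(h.quantile_le_iff hyI hlo).1 (h1.le.trans hcy.le), (h.lt_quantile_iff hyI hhi).1 hyhi⟩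
    have hbid := hA.bid_eq_of_mem_pool hpool h hi1 hiL hx.2 hyI hxi hyi
    have hy : t < (B.toDirect n).interimP f s y := by
      rw [← BRA.interimP_toDirect_congr s hbid]
      exact hx.1
    exact (hlub.1 ⟨hy, hyI⟩).not_gt hcy

theorem buyerOptimal : (B.toDirect n).BuyerOptimal f v := by
  have hB := hA.valid
  have hfeas := BRA.feasible_toDirect (n := n) h hB
  have hint : ∀ m : DirectMechanism n, m.Feasible f → ∀ s,
      Integrable (fun q => ironedSurplus f v (cdf f (q s)) * m.p s q) (profileLaw f n) :=
    fun m hm s => h.integrable_weight_mul_p hm h.integrable_ironedSurplus s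
  have hvalue : (B.toDirect n).buyerPayoff f v = ∫ q, ∑ s,
      ironedSurplus f v (cdf f (q s)) * (B.toDirect n).p s q ∂(profileLaw f n) := by
    rw [integral_finsetSum _ fun s _ => hint _ hfeas s]
    exact h.buyerPayoff_eq_of_levels hfeas
      (fun s x hx r hr => BRA.incentiveCompatible_toDirect h hB s hx hr)
      (fun s => BRA.sellerPayoff_toDirect_one h hB s)
      (fun s t ht c hc hlub => hA.coincide_of_isLUB hpool h s ht.1.le hc hlub)
  refine ⟨⟨hfeas, fun s => ae_restrict_of_forall_mem measurableSet_Icc fun x hx r hr =>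
    BRA.incentiveCompatible_toDirect h hB s hx hr, ?_, fun s x hx =>
    BRA.individuallyRational_toDirect h hB s hx⟩, fun m hm => ?_⟩
  · rw [hvalue]
    refine integral_nonneg_of_ae ?_
    filter_upwards [hA.ae_sum_ironedSurplus_le hpool h (n := n)] with q hq
    simpa using hq 0 (by simp) (by simp)
  · obtain ⟨hmf, hmIC, -, hmIR⟩ := hm
    refine (h.buyerPayoff_le hmf hmIC fun s => hmIR s 1 (by simp)).trans ?_
    rw [hvalue, ← integral_finsetSum _ fun s _ => hint _ hmf s]
    refine integral_mono_ae (integrable_finsetSum _ fun s _ => hint _ hmf s)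
      (integrable_finsetSum _ fun s _ => hint _ hfeas s) ?_
    filter_upwards [hA.ae_sum_ironedSurplus_le hpool h (n := n),
      h.ae_profile (Primitives.ae_mem_Icc (f := f))] with q hq hqI
    exact hq (fun s => m.p s q) (fun s => (hmf.p_mem s q hqI).1) (hmf.sum_p_le q hqI)

end Adapted

end Procurement

end

theorem theorem1 (n : ℕ) (hn : 2 ≤ n) (f v : ℝ → ℝ)
    (hf_cont : ContinuousOn f (Set.Icc 0 1))
    (hf_pos : ∀ q ∈ Set.Ioc (0 : ℝ) 1, 0 < f q)
    (hf_int : ∫ x in (0 : ℝ)..1, f x = 1)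
    (hf_zero : f 0 = 0 →
      Filter.Tendsto (fun q => Procurement.cdf f q / f q) (nhdsWithin 0 (Set.Ioi 0)) (nhds 0))
    (hv_cont : ContinuousOn v (Set.Icc 0 1))
    (hv_zero : 0 ≤ v 0)
    (hg : Procurement.Structured (Procurement.virtualSurplus f v)) :
    (∃ (L : ℕ) (lo hi : ℕ → ℝ), Procurement.IsPooling f v L lo hi) ∧
    ∀ (L : ℕ) (lo hi : ℕ → ℝ), Procurement.IsPooling f v L lo hi →
      (Procurement.poolingBRA f v L lo hi).Valid ∧
      (Procurement.poolingBRA f v L lo hi).BidWeaklyDominant n ∧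
      ((Procurement.poolingBRA f v L lo hi).toDirect n).BuyerOptimal f v := by
  have h : Procurement.Primitives f v := ⟨hf_cont, hf_pos, hf_int, hf_zero, hv_cont⟩
  refine ⟨h.exists_isPooling hg, fun L lo hi hpool => ?_⟩
  have hA := hpool.adapted_poolingBRA h
  exact ⟨hA.valid, hA.valid.bidWeaklyDominant n, hA.buyerOptimal hpool h⟩
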